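/- **Hashing with coalesced chains.** Let $0<n\le m$. Items $x_1,\dots,x_n$ with hash addresses $h_1,\dots,h_n\in\{1,\dots,m\}$ are inserted one after another into a table of $m$ initially empty cells, each with a link field that is initially null. If cell $h_i$ is empty, $x_i$ is stored there. Otherwise $x_i$ is stored in the empty cell $e$ with the largest index; under *late insertion* ($\mathsf L$) the last cell of the chain reached by following the links from $h_i$ is linked to $e$, and under *early insertion* ($\mathsf E$) $e$ is linked into the chain immediately after $h_i$ (the link of $e$ is set to the old link of $h_i$, and the link of $h_i$ is set to $e$). In the final table, the displacement $d_i^{\Xi}$ of $x_i$ under policy $\Xi\in\{\mathsf L,\mathsf E\}$ is the number of links to follow from $h_i$ until $x_i$ is found. For $1\le j\le m$, $d_j^{\mathsf U}$ is the number of occupied cells encountered in an unsuccessful search starting at $j$ (it is $0$ if cell $j$ is empty, and otherwise the number of cells from $j$, inclusive, to the end of its chain), and $\widetilde d_j^{\mathsf U}=\max(d_j^{\mathsf U},1)$ is the number of probes in that search. Let $\mathcal T_{m,n}$ be the random table with $h_1,\dots,h_n$ independent and uniform on $\{1,\dots,m\}$. Let $d^{\Xi}(\mathcal T_{m,n})=d^{\Xi}_I$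 for $\Xi\in\{\mathsf L,\mathsf E\}$, $d^{\mathsf U}(\mathcal T_{m,n})=d^{\mathsf U}_J$ and $\widetilde d^{\mathsf U}(\mathcal T_{m,n})=\widetilde d^{\mathsf U}_J$, where $I$ is uniform on $\{1,\dots,n\}$, $J$ is uniform on $\{1,\dots,m\}$, and both are independent of the table. (For $\mathsf U$ the table may be built under either policy.) For $\alpha\in[0,1]$ let $$p^{\mathsf U}_\alpha(0)=1-\alpha,\qquad p^{\mathsf U}_\alpha(k)=\int_0^\alpha(1-\alpha+t)(1-e^{-t})^{k-1}\,dt\quad(k\ge1),$$ $$p^{\mathsf L}_\alpha(0)=1-\tfrac\alpha2,\qquad p^{\mathsf L}_\alpha(k)=\frac1\alpha\int_0^\alpha\Bigl(\alpha-t-\tfrac{(\alpha-t)^2}2\Bigr)(1-e^{-t})^{k-1}\,dt\quad(k\ge1),$$ $$p^{\mathsf E}_\alpha(0)=1-\tfrac\alpha2,\qquad p^{\mathsf E}_\alpha(k)=\frac1\alpha\int_0^\alpha(\alpha-t)e^{-t}(1-e^{-t})^{k-1}\,dt\quad(k\ge1),$$ with $p_0^{\mathsf L}(k)=p_0^{\mathsf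 E}(k)=0$ for $k\ge1$. **Corollary 2.** Suppose that $m,n\to\infty$ with $0<n\le m$ and $n/m\to\alpha\in[0,1]$. Then $p^{\mathsf U}_\alpha,p^{\mathsf L}_\alpha,p^{\mathsf E}_\alpha$ are probability distributions on $\{0,1,2,\dots\}$ with finite second moments; and if $D^{\mathsf U}_\alpha,D^{\mathsf L}_\alpha,D^{\mathsf E}_\alpha$ are random variables with these distributions and $\widetilde D^{\mathsf U}_\alpha=\max(D^{\mathsf U}_\alpha,1)$, then $$\operatorname{Var}(d^{\mathsf U}(\mathcal T_{m,n}))\to\operatorname{Var}D^{\mathsf U}_\alpha=-\tfrac1{16}e^{4\alpha}+\tfrac49e^{3\alpha}-\bigl(\tfrac14\alpha+\tfrac18\bigr)e^{2\alpha}-\tfrac14\alpha^2+\tfrac5{12}\alpha-\tfrac{37}{144},$$ $$\operatorname{Var}(d^{\mathsf L}(\mathcal T_{m,n}))\to\operatorname{Var}D^{\mathsf L}_\alpha=-\tfrac1{64}\Bigl(\frac{e^{2\alpha}-1}{\alpha}\Bigr)^2+\frac{64e^{2\alpha}+37e^{\alpha}+37}{432}\cdot\frac{e^\alpha-1}{\alpha}-\tfrac1{16}e^{2\alpha}-\tfrac1{16}\alpha^2+\tfrac5{24}\alpha-\tfrac7{36},$$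 $$\operatorname{Var}(d^{\mathsf E}(\mathcal T_{m,n}))\to\operatorname{Var}D^{\mathsf E}_\alpha=\frac{\alpha-2}2\Bigl(\frac{e^\alpha-1}\alpha\Bigr)^2+2\,\frac{e^\alpha-1}\alpha-1,$$ and, for the number of probes in an unsuccessful search, $$\operatorname{Var}(\widetilde d^{\mathsf U}(\mathcal T_{m,n}))\to\operatorname{Var}\widetilde D^{\mathsf U}_\alpha=-\tfrac1{16}e^{4\alpha}+\tfrac49e^{3\alpha}+\bigl(\tfrac14\alpha-\tfrac58\bigr)e^{2\alpha}-\tfrac14\alpha^2-\tfrac1{12}\alpha+\tfrac{35}{144}.$$ For $\alpha=0$ the quotients $(e^\alpha-1)/\alpha$ and $(e^{2\alpha}-1)/\alpha$ are read as their limits $1$ and $2$. -/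

import Mathlib

open MeasureTheory ProbabilityTheory

/-! Hashing with coalesced chains. -/

namespace CoalescedHashing

/-- The two insertion policies: `late` links a new cell at the end of the chain,
`early` links it immediately after the hash address. -/
inductive Policy where
  | late
  | early

/-- A hash table with `m` cells for items indexed by `Fin n`: the content of each cell
(`none` if the cell is empty) and its link field (`none` is the null link). -/
structure Table (m n : ℕ) where
  item : Fin m → Option (Fin n)
  link : Fin m → Option (Fin m)

namespace Table

variable {m n : ℕ}

/-- The initial table: all cells are empty, all links are null. -/
def init (m n : ℕ) : Table m n := ⟨fun _ => none, fun _ => none⟩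

/-- The cells met when following links from `j` until a null link, at most `fuel` of them. -/
def walk (T : Table m n) : (fuel : ℕ) → (j : Fin m) → List (Fin m)
  | 0, _ => []
  | fuel + 1, j =>
    j :: (match T.link j with
      | none => []
      | some k => T.walk fuel k)

/-- The cell `j` and all the cells after it in its chain, in order.  (A chain is a path in a
set of `m` cells, so that `m` steps exhaust it.) -/
def chainFrom (T : Table m n) (j : Fin m) : List (Fin m) := T.walk m j

/-- The last cell of the chain that contains `j`. -/
def chainEnd (T : Table m n) (j : Fin m) : Fin m := (T.chainFrom j).getLastD j

/-- The set of empty cells. -/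
def emptyCells (T : Table m n) : Finset (Fin m) := Finset.univ.filter fun c => T.item c = none

/-- Insertion of item `i` with hash address `h`.  If cell `h` is empty, the item is stored
there.  Otherwise it is stored in the empty cell `e` with largest index; under the late policy
the last cell of the chain is linked to `e`, under the early policy `e` is linked into the
chain immediately after `h`.  (A full table is left unchanged; this never happens when at most
`m` items are inserted.) -/
def insert (P : Policy) (T : Table m n) (i : Fin n) (h : Fin m) : Table m n :=
  if T.item h = none then
    { T with item := Function.update T.item h (some i) }
  else if hne : T.emptyCells.Nonempty then
    let e : Fin m := T.emptyCells.max' hne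
    { item := Function.update T.item e (some i)
      link :=
        match P with
        | .late => Function.update T.link (T.chainEnd h) (some e)
        | .early => Function.update (Function.update T.link e (T.link h)) h (some e) }
  else T

/-- The final table, after the items `0, 1, …, n - 1` have been inserted, in this order, with
hash addresses `h 0, h 1, …`. -/
def build (P : Policy) (h : Fin n → Fin m) : Table m n :=
  (List.finRange n).foldl (fun T i => T.insert P i (h i)) (init m n)

end Table

variable {m n : ℕ}

/-- The (final) displacement of item `i`: the number of links to follow from its hash address
until the item is found. -/
def displacement (P : Policy) (h : Fin n → Fin m) (i : Fin n) : ℕ :=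
  ((Table.build P h).chainFrom (h i)).findIdx fun c =>
    decide ((Table.build P h).item c = some i)

/-- The number of occupied cells encountered in an unsuccessful search starting at `j`. -/
def unsuccessfulCost (P : Policy) (h : Fin n → Fin m) (j : Fin m) : ℕ :=
  ((Table.build P h).chainFrom j).countP fun c => ((Table.build P h).item c).isSome

/-- The number of probes in an unsuccessful search starting at `j`: an empty cell at the hash
address also has to be probed. -/
def unsuccessfulProbes (P : Policy) (h : Fin n → Fin m) (j : Fin m) : ℕ :=
  max (unsuccessfulCost P h j) 1

noncomputable section

/-- The law of `n` independent hash addresses, each uniform on the `m` cells. -/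
def hashLaw (m n : ℕ) : Measure (Fin n → Fin m) :=
  Measure.pi fun _ => uniformOn (Set.univ : Set (Fin m))

/-- The variance of the displacement of a uniformly random item of the random table. -/
def varDisplacement (P : Policy) (m n : ℕ) : ℝ :=
  Var[fun ω : (Fin n → Fin m) × Fin n => (displacement P ω.1 ω.2 : ℝ);
    (hashLaw m n).prod (uniformOn Set.univ)]

/-- The variance of the number of occupied cells encountered in an unsuccessful search that
starts at a uniformly random address of the random table. -/
def varUnsuccessfulCost (P : Policy) (m n : ℕ) : ℝ :=
  Var[fun ω : (Fin n → Fin m) × Fin m => (unsuccessfulCost P ω.1 ω.2 : ℝ);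
    (hashLaw m n).prod (uniformOn Set.univ)]

/-- The variance of the number of probes in an unsuccessful search that starts at a uniformly
random address of the random table. -/
def varUnsuccessfulProbes (P : Policy) (m n : ℕ) : ℝ :=
  Var[fun ω : (Fin n → Fin m) × Fin m => (unsuccessfulProbes P ω.1 ω.2 : ℝ);
    (hashLaw m n).prod (uniformOn Set.univ)]

/-- The limit probabilities for the cost of an unsuccessful search. -/
def pU (α : ℝ) : ℕ → ℝ
  | 0 => 1 - α
  | k + 1 => ∫ t in (0 : ℝ)..α, (1 - α + t) * (1 - Real.exp (-t)) ^ k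

/-- The limit probabilities for the displacement under late insertion.  (For `α = 0` the
probabilities of `1, 2, …` are `0`.) -/
def pL (α : ℝ) : ℕ → ℝ
  | 0 => 1 - α / 2
  | k + 1 => if α = 0 then 0 else
      α⁻¹ * ∫ t in (0 : ℝ)..α, (α - t - (α - t) ^ 2 / 2) * (1 - Real.exp (-t)) ^ k

/-- The limit probabilities for the displacement under early insertion.  (For `α = 0` the
probabilities of `1, 2, …` are `0`.) -/
def pE (α : ℝ) : ℕ → ℝ
  | 0 => 1 - α / 2
  | k + 1 => if α = 0 then 0 else
      α⁻¹ * ∫ t in (0 : ℝ)..α, (α - t) * Real.exp (-t) * (1 - Real.exp (-t)) ^ k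

/-- The measure on `ℕ` that gives mass `p k` to `k`. -/
def law (p : ℕ → ℝ) : Measure ℕ :=
  Measure.sum fun k => ENNReal.ofReal (p k) • Measure.dirac k

/-- `p` is a probability distribution on `ℕ` with a finite second moment. -/
def IsDistribution (p : ℕ → ℝ) : Prop :=
  (∀ k, 0 ≤ p k) ∧ HasSum p 1 ∧ Summable fun k : ℕ => (k : ℝ) ^ 2 * p k

/-- `(e ^ (c α) - 1) / α`, extended by continuity to `α = 0`. -/
def expQuot (c α : ℝ) : ℝ := if α = 0 then c else (Real.exp (c * α) - 1) / α

end

end CoalescedHashing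

/-! The variances are computed exactly for finite `m` and `n`; no convergence in distribution is
needed. Let a table with `k` occupied cells receive an item, let `f 0 = 0`, and sum over all `m`
hash addresses. Under early insertion a search of cost `d` is prolonged by one for exactly `d` of
the addresses. The new cell gets the old cost of the address if that was occupied, and cost 1
otherwise. Hence the total of `f (cost)` becomes `m * ∑ f d + (m - k) * f 1 + ∑ (d * (f (d + 1) - f
d) + f d)` (`Table.sum_sum_cost_insert`). Late insertion gives the same total, because chains are
disjoint paths and the costs along a chain of length `ℓ` are `1, …, ℓ` under either policy. For `f d
= d` and `f d = d * (d + 1)` the last summand is `κ * f d` with `κ = 2` and `κ = 3`, so the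
recurrence closes and is solved by powers of `1 + κ / m` (`totalCost_eq`).

Under late insertion a displacement never changes after the item is stored. It equals the cost of a
search from the item's own address just before, and that address is independent of the table at that
time; so `sum_displacement_late` sums the previous formula over time. Under early insertion a
displacement starts as 0 or 1, and a displacement `d` grows by one for exactly `d` of the `m` later
addresses; the same two functions satisfy a closed recurrence with `κ = 1` and `κ = 2`
(`totalDisp_eq`).

As `n / m → α`, the power `(1 + κ / m) ^ n` tends to `exp (κ * α)`, which gives the limits of the
variances. For the limit laws, put `x = 1 - exp (-t)`: then `1 / (1 - x) = exp t`, so the series for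
the total mass and the first two moments become integrals of a weight against powers of `exp t`
(`isDistribution_of_weight`). The two computations yield the same moments. -/

namespace CoalescedHashing

/-! ### Chains as disjoint paths -/

namespace Table

variable {m n : ℕ}

/-- `ch j` is the chain of the table `T` from the cell `j` on: following links from `j` never
repeats a cell, links connect occupied cells, and no two cells link to the same one. -/
structure WellLinked (T : Table m n) (ch : Fin m → List (Fin m)) : Prop where
  unfold : ∀ j, ch j = j :: (T.link j).elim [] ch
  nodup : ∀ j, (ch j).Nodup
  source_occ : ∀ j k, T.link j = some k → T.item j ≠ none
  target_occ : ∀ j k, T.link j = some k → T.item k ≠ none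
  inj : ∀ i j k, T.link i = some k → T.link j = some k → i = j

namespace WellLinked

variable {T : Table m n} {ch : Fin m → List (Fin m)}

/-- Fuel only truncates the chain. A chain without repetition has at most `m` cells, so fuel `m`
loses nothing, and `ch` is determined by the table. -/
theorem walk_eq_take (H : T.WellLinked ch) (fuel : ℕ) (j : Fin m) :
    T.walk fuel j = (ch j).take fuel := by
  induction fuel generalizing j with
  | zero => simp [walk]
  | succ k ih =>
    rw [H.unfold j, walk]
    cases hl : T.link j with
    | none => simp
    | some c => simp [ih]

theorem chainFrom_eq (H : T.WellLinked ch) (j : Fin m) : T.chainFrom j = ch j := by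
  rw [chainFrom, H.walk_eq_take, List.take_of_length_le]
  simpa using (H.nodup j).length_le_card

theorem chainFrom_eq_fun (H : T.WellLinked ch) : T.chainFrom = ch :=
  funext H.chainFrom_eq

theorem eq_of_link_none (H : T.WellLinked ch) {j : Fin m} (h : T.link j = none) : ch j = [j] := by
  rw [H.unfold, h]; rfl

theorem eq_of_link_some (H : T.WellLinked ch) {j k : Fin m} (h : T.link j = some k) :
    ch j = j :: ch k := by
  rw [H.unfold, h]; rfl

theorem mem_self (H : T.WellLinked ch) (j : Fin m) : j ∈ ch j := by
  rw [H.unfold]; simp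

theorem ne_nil (H : T.WellLinked ch) (j : Fin m) : ch j ≠ [] :=
  List.ne_nil_of_mem (H.mem_self j)

theorem length_pos (H : T.WellLinked ch) (j : Fin m) : 0 < (ch j).length :=
  List.length_pos_of_mem (H.mem_self j)

theorem link_of_empty (H : T.WellLinked ch) {j : Fin m} (h : T.item j = none) :
    T.link j = none := by
  cases hl : T.link j with
  | none => rfl
  | some k => exact absurd h (H.source_occ j k hl)

theorem eq_of_empty (H : T.WellLinked ch) {j : Fin m} (h : T.item j = none) : ch j = [j] :=
  H.eq_of_link_none (H.link_of_empty h)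

/-- Induction along the chains, from their ends. -/
theorem induction (H : T.WellLinked ch) {p : Fin m → Prop}
    (end_ : ∀ j, T.link j = none → p j) (step : ∀ j k, T.link j = some k → p k → p j)
    (j : Fin m) : p j := by
  suffices ∀ N j, (ch j).length ≤ N → p j from this _ j le_rfl
  intro N
  induction N with
  | zero => intro j hj; exact absurd hj (by have := H.length_pos j; omega)
  | succ N ih =>
    intro j hj
    cases hl : T.link j with
    | none => exact end_ j hl
    | some k =>
      rw [H.eq_of_link_some hl] at hj
      exact step j k hl (ih k (by simpa using hj))

theorem mem_cases (H : T.WellLinked ch) {c j : Fin m} (h : c ∈ ch j) :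
    c = j ∨ ∃ k, T.link j = some k ∧ c ∈ ch k := by
  rw [H.unfold] at h
  cases hl : T.link j with
  | none => rw [hl] at h; left; simpa using h
  | some k => rw [hl] at h; simpa using h

theorem suffix (H : T.WellLinked ch) {c : Fin m} (j : Fin m) : c ∈ ch j → ch c <:+ ch j := by
  induction j using H.induction with
  | end_ j hl => intro h; rw [H.eq_of_link_none hl] at h; simp_all
  | step j k hl ih =>
    intro h
    rw [H.eq_of_link_some hl] at h ⊢
    rcases List.mem_cons.1 h with rfl | h
    · rw [H.eq_of_link_some hl]
    · exact (ih h).trans (List.suffix_cons _ _)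

theorem trans (H : T.WellLinked ch) {a b c : Fin m} (hab : b ∈ ch a) (hbc : c ∈ ch b) :
    c ∈ ch a :=
  (H.suffix a hab).subset hbc

/-- Each chain is a suffix of the other, so the two lists coincide and so do their heads. -/
theorem antisymm (H : T.WellLinked ch) {a b : Fin m} (hab : b ∈ ch a) (hba : a ∈ ch b) :
    a = b := by
  have h := (H.suffix a hab).eq_of_length_le (H.suffix b hba).length_le
  rw [H.unfold a, H.unfold b] at h
  exact ((List.cons.inj h).1).symm

theorem mem_occ (H : T.WellLinked ch) {c j : Fin m} (h : c ∈ ch j) (hj : T.item j ≠ none) :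
    T.item c ≠ none := by
  induction j using H.induction with
  | end_ j hl => rw [H.eq_of_link_none hl] at h; simp_all
  | step j k hl ih =>
    rcases H.mem_cases h with rfl | ⟨k', hk', h⟩
    · exact hj
    · rw [hl] at hk'; cases hk'; exact ih h (H.target_occ _ _ hl)

theorem occ_of_mem (H : T.WellLinked ch) {c j : Fin m} (h : c ∈ ch j) (hc : T.item c ≠ none) :
    T.item j ≠ none := by
  intro hj
  rw [H.eq_of_empty hj, List.mem_singleton] at h
  exact hc (h ▸ hj)

theorem exists_pred (H : T.WellLinked ch) {c : Fin m} (j : Fin m) (h : c ∈ ch j) (hc : c ≠ j) :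
    ∃ i ∈ ch j, T.link i = some c := by
  induction j using H.induction with
  | end_ j hl => rw [H.eq_of_link_none hl] at h; simp_all
  | step j k hl ih =>
    rcases H.mem_cases h with rfl | ⟨k', hk', h⟩
    · exact absurd rfl hc
    · rw [hl] at hk'; cases hk'
      by_cases hck : c = k
      · exact ⟨j, H.mem_self j, by rw [hl, hck]⟩
      · obtain ⟨i, hi, hl'⟩ := ih h hck
        exact ⟨i, by rw [H.eq_of_link_some hl]; exact List.mem_cons_of_mem _ hi, hl'⟩

/-- This is where injectivity of the links enters: going backwards from `c` there is no branching,
so chains are paths and not merely trees. -/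
theorem comparable (H : T.WellLinked ch) {c j' : Fin m} (j : Fin m) (h : c ∈ ch j)
    (h' : c ∈ ch j') : j ∈ ch j' ∨ j' ∈ ch j := by
  induction j using H.induction with
  | end_ j hl => rw [H.eq_of_link_none hl] at h; left; simp_all
  | step j k hl ih =>
    rcases H.mem_cases h with rfl | ⟨k', hk', h⟩
    · exact Or.inl h'
    · rw [hl] at hk'; cases hk'
      have hjk : k ∈ ch j := by rw [H.eq_of_link_some hl]; exact List.mem_cons_of_mem _ (H.mem_self k)
      rcases ih h with h1 | h1
      · by_cases hk : k = j'
        · exact Or.inr (hk ▸ hjk)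
        · obtain ⟨i, hi, hli⟩ := H.exists_pred j' h1 hk
          exact Or.inl (H.inj _ _ _ hl hli ▸ hi)
      · exact Or.inr (H.trans hjk h1)

theorem link_chainEnd (H : T.WellLinked ch) (j : Fin m) : T.link (T.chainEnd j) = none := by
  unfold chainEnd; rw [H.chainFrom_eq]
  induction j using H.induction with
  | end_ j hl => rw [H.eq_of_link_none hl]; simpa using hl
  | step j k hl ih =>
    rw [H.eq_of_link_some hl]
    rw [List.getLastD_eq_getLast?, List.getLast?_eq_some_getLast (H.ne_nil k)] at ih
    rw [List.getLastD_eq_getLast?, List.getLast?_cons, Option.getD_some,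
      List.getLast?_eq_some_getLast (H.ne_nil k)]
    exact ih

theorem chainEnd_mem (H : T.WellLinked ch) (j : Fin m) : T.chainEnd j ∈ ch j := by
  unfold chainEnd; rw [H.chainFrom_eq, List.getLastD_eq_getLast?,
    List.getLast?_eq_some_getLast (H.ne_nil j)]
  exact List.getLast_mem _

/-- The searches that pass the end of the chain of `h` are those from cells before or after `h` on
its path. These are the searches that late insertion at `h` prolongs. -/
theorem chainEnd_mem_iff (H : T.WellLinked ch) (h j : Fin m) :
    T.chainEnd h ∈ ch j ↔ j ∈ ch h ∨ h ∈ ch j := by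
  constructor
  · intro hj; exact H.comparable j hj (H.chainEnd_mem h)
  · rintro (hj | hj)
    · obtain ⟨l, hl⟩ := H.suffix h hj
      have h1 : T.chainEnd h = T.chainEnd j := by
        unfold chainEnd
        rw [H.chainFrom_eq, H.chainFrom_eq, ← hl, List.getLastD_eq_getLast?,
          List.getLastD_eq_getLast?, List.getLast?_append_of_ne_nil _ (H.ne_nil j),
          List.getLast?_eq_some_getLast (H.ne_nil j)]
        rfl
      rw [h1]; exact H.chainEnd_mem j
    · exact H.trans hj (H.chainEnd_mem h)

/-- The lengths of the chains that start in the chain from `j` are `1, 2, …`. -/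
theorem sum_length (H : T.WellLinked ch) (g : ℕ → ℝ) (j : Fin m) :
    ((ch j).map fun c => g (ch c).length).sum = ∑ l ∈ Finset.range (ch j).length, g (l + 1) := by
  induction j using H.induction with
  | end_ j hl => simp [H.eq_of_link_none hl]
  | step j k hl ih =>
    rw [H.eq_of_link_some hl, List.map_cons, List.sum_cons, ih, List.length_cons,
      Finset.sum_range_succ, H.eq_of_link_some hl, List.length_cons, add_comm]

end WellLinked

/-! ### Costs, and chains after a change of the table -/

/-- The number of occupied cells met from `j` on. -/
def cost (T : Table m n) (j : Fin m) : ℕ :=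
  (T.chainFrom j).countP fun c => (T.item c).isSome

namespace WellLinked

variable {T : Table m n} {ch : Fin m → List (Fin m)}

theorem cost_of_empty (H : T.WellLinked ch) {j : Fin m} (hj : T.item j = none) :
    T.cost j = 0 := by
  rw [cost, H.chainFrom_eq, H.eq_of_empty hj]; simp [hj]

theorem cost_of_occ (H : T.WellLinked ch) {j : Fin m} (hj : T.item j ≠ none) :
    T.cost j = (ch j).length := by
  rw [cost, H.chainFrom_eq, List.countP_eq_length]
  intro c hc
  exact Option.isSome_iff_ne_none.2 (H.mem_occ hc hj)

/-- Storing an item in a cell does not affect the links. -/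
theorem store (H : T.WellLinked ch) (i : Fin n) (e : Fin m) :
    WellLinked { T with item := Function.update T.item e (some i) } ch where
  unfold := H.unfold
  nodup := H.nodup
  source_occ j k hl := by
    by_cases hj : j = e
    · simp [hj]
    · simpa [hj] using H.source_occ j k hl
  target_occ j k hl := by
    by_cases hj : k = e
    · simp [hj]
    · simpa [hj] using H.target_occ j k hl
  inj := H.inj

theorem not_mem_of_empty (H : T.WellLinked ch) {e j : Fin m} (he : T.item e = none)
    (hj : j ≠ e) : e ∉ ch j := by
  intro h
  obtain ⟨i, _, hi⟩ := H.exists_pred j h hj.symm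
  exact H.target_occ _ _ hi he

/-- Linking a free cell at the end of a chain. -/
theorem link_late (H : T.WellLinked ch) (i : Fin n) {e ε : Fin m} (he : T.item e = none)
    (hε : T.item ε ≠ none) (hl : T.link ε = none) :
    WellLinked
      { item := Function.update T.item e (some i), link := Function.update T.link ε (some e) }
      (fun j => if ε ∈ ch j then ch j ++ [e] else ch j) where
  unfold j := by
    have heε : e ≠ ε := by rintro rfl; exact hε he
    by_cases hj : j = ε
    · subst hj
      simp [H.eq_of_empty he, H.eq_of_link_none hl, heε.symm]
    · simp only [Function.update_of_ne hj]
      cases hlj : T.link j with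
      | none => simp [H.eq_of_link_none hlj, Ne.symm hj]
      | some k =>
        simp only [H.eq_of_link_some hlj, List.mem_cons, Ne.symm hj, false_or, Option.elim]
        split_ifs <;> simp
  nodup j := by
    split_ifs with h
    · have hj : j ≠ e := by rintro rfl; exact H.occ_of_mem h hε he
      exact List.nodup_append.2 ⟨H.nodup j, by simp, by
        have := H.not_mem_of_empty he hj
        intro a ha b hb; rw [List.mem_singleton] at hb; rintro rfl; exact this (hb ▸ ha)⟩
    · exact H.nodup j
  source_occ j k hjk := by
    by_cases hj : j = e
    · simp [hj]
    · simp only [Function.update_of_ne hj]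
      by_cases hjε : j = ε
      · rwa [hjε]
      · simp only [Function.update_of_ne hjε] at hjk; exact H.source_occ _ _ hjk
  target_occ j k hjk := by
    by_cases hk : k = e
    · simp [hk]
    · simp only [Function.update_of_ne hk]
      by_cases hjε : j = ε
      · simp [hjε] at hjk; exact absurd hjk.symm hk
      · simp only [Function.update_of_ne hjε] at hjk; exact H.target_occ _ _ hjk
  inj a b k ha hb := by
    by_cases ha' : a = ε <;> by_cases hb' : b = ε
    · rw [ha', hb']
    · simp [ha', hb'] at ha hb; subst ha; exact absurd he (H.target_occ _ _ hb)
    · simp [ha', hb'] at ha hb; subst hb; exact absurd he (H.target_occ _ _ ha)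
    · simp [ha', hb'] at ha hb; exact H.inj _ _ _ ha hb

end WellLinked

end Table

/-! ### Inserting into a list after a given entry -/

/-- The list `l` with `e` inserted after each occurrence of `h`. -/
def insertAfter {α : Type*} [DecidableEq α] (h e : α) : List α → List α
  | [] => []
  | a :: l => if a = h then a :: e :: insertAfter h e l else a :: insertAfter h e l

section insertAfter

variable {α : Type*} [DecidableEq α] {h e : α}

theorem insertAfter_of_notMem {l : List α} (hl : h ∉ l) : insertAfter h e l = l := by
  induction l with
  | nil => rfl
  | cons a l ih =>
    simp only [List.mem_cons, not_or] at hl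
    simp [insertAfter, Ne.symm hl.1, ih hl.2]

theorem mem_insertAfter {l : List α} {c : α} :
    c ∈ insertAfter h e l ↔ c ∈ l ∨ (c = e ∧ h ∈ l) := by
  induction l with
  | nil => simp [insertAfter]
  | cons a l ih =>
    by_cases ha : a = h
    · simp [insertAfter, ha, ih]; tauto
    · simp [insertAfter, ha, ih, Ne.symm ha]; tauto

theorem nodup_insertAfter {l : List α} (hl : l.Nodup) (he : e ∉ l) :
    (insertAfter h e l).Nodup := by
  induction l with
  | nil => exact hl
  | cons a l ih =>
    simp only [List.nodup_cons, List.mem_cons, not_or] at hl he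
    by_cases ha : a = h
    · subst ha
      simp [insertAfter, insertAfter_of_notMem hl.1, hl, he.2, Ne.symm he.1]
    · simp [insertAfter, ha, mem_insertAfter, ih hl.2 he.2, hl.1, Ne.symm he.1]

theorem length_insertAfter {l : List α} (hl : l.Nodup) :
    (insertAfter h e l).length = l.length + if h ∈ l then 1 else 0 := by
  induction l with
  | nil => simp [insertAfter]
  | cons a l ih =>
    simp only [List.nodup_cons] at hl
    by_cases ha : a = h
    · subst ha
      simp [insertAfter, insertAfter_of_notMem hl.1]
    · simp only [insertAfter, ha, ih hl.2, List.length_cons, List.mem_cons, Ne.symm ha, false_or,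
        if_false]
      omega

/-- An entry is pushed back exactly when `h` stands strictly before it, and the entries strictly
before `c` are those of `l.take (l.idxOf c)`. -/
theorem idxOf_insertAfter {l : List α} (hl : l.Nodup) {c : α} (hc : c ≠ e) :
    (insertAfter h e l).idxOf c = l.idxOf c + if h ∈ l.take (l.idxOf c) then 1 else 0 := by
  induction l with
  | nil => simp [insertAfter]
  | cons a l ih =>
    simp only [List.nodup_cons] at hl
    by_cases hac : a = c
    · subst hac
      simp only [insertAfter]; split_ifs <;> simp_all
    · by_cases ha : a = h
      · subst ha
        simp [insertAfter, insertAfter_of_notMem hl.1, List.idxOf_cons_ne, hac, Ne.symm hc]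
      · simp only [insertAfter, ha, if_false, List.idxOf_cons_ne _ hac, ih hl.2,
          Nat.succ_eq_add_one, List.take_succ_cons, List.mem_cons, Ne.symm ha, false_or]
        omega

end insertAfter

namespace Table

variable {m n : ℕ} {T : Table m n} {ch : Fin m → List (Fin m)}

/-- Linking a free cell into a chain after the cell `h`. -/
theorem WellLinked.link_early (H : T.WellLinked ch) (i : Fin n) {e h : Fin m}
    (he : T.item e = none) (hh : T.item h ≠ none) :
    WellLinked
      { item := Function.update T.item e (some i)
        link := Function.update (Function.update T.link e (T.link h)) h (some e) }
      (fun j => if j = e then e :: (ch h).tail else insertAfter h e (ch j)) := by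
  have heh : e ≠ h := by rintro rfl; exact hh he
  have htail : (ch h).tail = (T.link h).elim [] ch := by rw [H.unfold]; rfl
  -- Since `h` does not recur after itself, `insertAfter h e` leaves the tail unchanged; this makes
  -- the new chains from `h` and from `e` agree.
  have hnt : h ∉ (ch h).tail := by
    have := H.nodup h
    rw [H.unfold, List.nodup_cons] at this
    rw [htail]; exact this.1
  have hlink : ∀ j, j ≠ e → j ≠ h →
      Function.update (Function.update T.link e (T.link h)) h (some e) j = T.link j := by
    intro j h1 h2; simp [h1, h2]
  have htarget : ∀ {j k}, T.link j = some k → k ≠ e := by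
    rintro j k hl rfl; exact H.target_occ _ _ hl he
  constructor
  · intro j
    by_cases hj : j = e
    · subst hj
      simp only [Function.update_of_ne heh, Function.update_self, if_true]
      congr 1
      rw [htail]
      cases hl : T.link h with
      | none => rfl
      | some k =>
        simp only [Option.elim, htarget hl, if_false]
        rw [insertAfter_of_notMem]
        rw [htail, hl] at hnt; exact hnt
    · by_cases hjh : j = h
      · subst hjh
        simp only [Function.update_self, Option.elim, if_true, if_neg hj]
        conv_lhs => rw [H.unfold, ← htail]
        simp [insertAfter, insertAfter_of_notMem hnt]
      · simp only [hlink j hj hjh, if_neg hj]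
        rw [H.unfold]
        cases hl : T.link j with
        | none => simp [insertAfter, hjh]
        | some k => simp [insertAfter, hjh, htarget hl]
  · intro j
    split_ifs with hj
    · rw [List.nodup_cons]
      exact ⟨fun h' => H.not_mem_of_empty he heh.symm (List.mem_of_mem_tail h'),
        (H.nodup h).tail⟩
    · exact nodup_insertAfter (H.nodup j) (H.not_mem_of_empty he hj)
  · intro j k hjk
    by_cases hj : j = e
    · simp [hj]
    · simp only [Function.update_of_ne hj]
      by_cases hjh : j = h
      · rwa [hjh]
      · simp only [hlink j hj hjh] at hjk; exact H.source_occ _ _ hjk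
  · intro j k hjk
    by_cases hk : k = e
    · simp [hk]
    · simp only [Function.update_of_ne hk]
      by_cases hjh : j = h
      · simp [hjh] at hjk; exact absurd hjk.symm hk
      · by_cases hj : j = e
        · simp [hj, heh] at hjk; exact H.target_occ _ _ hjk
        · simp only [hlink j hj hjh] at hjk; exact H.target_occ _ _ hjk
  · intro a b k ha hb
    -- Three kinds of link: the new one from `h` to `e`, the old link of `h` now leaving `e`, and
    -- the untouched ones. Old targets differ from `e` because `e` was empty.
    have key : ∀ j, Function.update (Function.update T.link e (T.link h)) h (some e) j = some k →
        (j = h ∧ k = e) ∨ (j = e ∧ T.link h = some k ∧ k ≠ e) ∨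
          (j ≠ e ∧ j ≠ h ∧ T.link j = some k ∧ k ≠ e) := by
      intro j hj
      by_cases hjh : j = h
      · left; simp [hjh] at hj; exact ⟨hjh, hj.symm⟩
      · by_cases hje : j = e
        · simp [hje, heh] at hj; exact Or.inr (Or.inl ⟨hje, hj, htarget hj⟩)
        · rw [hlink j hje hjh] at hj; exact Or.inr (Or.inr ⟨hje, hjh, hj, htarget hj⟩)
    have hinj := fun a b => H.inj a b k
    rcases key a ha with ⟨h1, h2⟩ | ⟨h1, h2, h3⟩ | ⟨h1, h2, h3, h4⟩ <;>
    rcases key b hb with ⟨h1', h2'⟩ | ⟨h1', h2', h3'⟩ | ⟨h1', h2', h3', h4'⟩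
    · rw [h1, h1']
    · exact absurd h2 h3'
    · exact absurd h2 h4'
    · exact absurd h2' h3
    · rw [h1, h1']
    · exact absurd (hinj _ _ h3' h2) h2'
    · exact absurd h2' h4
    · exact absurd (hinj _ _ h3 h2') h2
    · exact hinj _ _ h3 h3'

end Table

/-! ### One insertion into a valid table -/

namespace Table

variable {m n : ℕ} {T : Table m n}

/-- The links of `T` form disjoint chains of occupied cells. -/
def Valid (T : Table m n) : Prop := T.WellLinked T.chainFrom

theorem WellLinked.valid {ch : Fin m → List (Fin m)} (H : T.WellLinked ch) : T.Valid := by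
  rw [Valid, H.chainFrom_eq_fun]; exact H

theorem valid_init (m n : ℕ) : (init m n).Valid :=
  WellLinked.valid (ch := fun j => [j])
    { unfold := fun _ => rfl
      nodup := by simp
      source_occ := by simp [init]
      target_occ := by simp [init]
      inj := by simp [init] }

theorem insert_of_empty (P : Policy) (i : Fin n) {h : Fin m} (hh : T.item h = none) :
    T.insert P i h = { T with item := Function.update T.item h (some i) } := by
  simp [insert, hh]

/-- The rule selecting `e` is forgotten on purpose: all later arguments use only that `e` was empty.
-/
theorem exists_insert_late (hT : T.emptyCells.Nonempty) (i : Fin n) :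
    ∃ e, T.item e = none ∧ ∀ h, T.item h ≠ none → T.insert .late i h =
      { item := Function.update T.item e (some i)
        link := Function.update T.link (T.chainEnd h) (some e) } := by
  refine ⟨T.emptyCells.max' hT, ?_, fun h hh => by simp [insert, hh, hT]⟩
  simpa [emptyCells] using T.emptyCells.max'_mem hT

theorem exists_insert_early (hT : T.emptyCells.Nonempty) (i : Fin n) :
    ∃ e, T.item e = none ∧ ∀ h, T.item h ≠ none → T.insert .early i h =
      { item := Function.update T.item e (some i)
        link := Function.update (Function.update T.link e (T.link h)) h (some e) } := by
  refine ⟨T.emptyCells.max' hT, ?_, fun h hh => by simp [insert, hh, hT]⟩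
  simpa [emptyCells] using T.emptyCells.max'_mem hT

theorem Valid.insert (H : T.Valid) (hT : T.emptyCells.Nonempty) (P : Policy) (i : Fin n)
    (h : Fin m) : (T.insert P i h).Valid := by
  by_cases hh : T.item h = none
  · rw [insert_of_empty P i hh]; exact (WellLinked.store H i h).valid
  · cases P with
    | late =>
      obtain ⟨e, he, hins⟩ := exists_insert_late hT i
      rw [hins h hh]
      exact (WellLinked.link_late H i he (WellLinked.mem_occ H (WellLinked.chainEnd_mem H h) hh)
        (WellLinked.link_chainEnd H h)).valid
    | early =>
      obtain ⟨e, he, hins⟩ := exists_insert_early hT i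
      rw [hins h hh]
      exact (WellLinked.link_early H i he hh).valid

/-- The set of occupied cells. -/
def occupied (T : Table m n) : Finset (Fin m) := Finset.univ.filter fun c => T.item c ≠ none

theorem mem_occupied {c : Fin m} : c ∈ T.occupied ↔ T.item c ≠ none := by simp [occupied]

theorem card_emptyCells_add_card_occupied : T.emptyCells.card + T.occupied.card = m := by
  have := Finset.card_filter_add_card_filter_not (s := (Finset.univ : Finset (Fin m)))
    (fun c => T.item c = none)
  simpa [emptyCells, occupied] using this

theorem emptyCells_nonempty (h : T.occupied.card < m) : T.emptyCells.Nonempty := by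
  rw [← Finset.card_pos]
  have := T.card_emptyCells_add_card_occupied
  omega

theorem exists_insert_item (hT : T.emptyCells.Nonempty) (P : Policy) (i : Fin n) (h : Fin m) :
    ∃ e, T.item e = none ∧ (T.insert P i h).item = Function.update T.item e (some i) := by
  by_cases hh : T.item h = none
  · exact ⟨h, hh, by rw [insert_of_empty P i hh]⟩
  · cases P with
    | late =>
      obtain ⟨e, he, hins⟩ := exists_insert_late hT i
      exact ⟨e, he, by rw [hins h hh]⟩
    | early =>
      obtain ⟨e, he, hins⟩ := exists_insert_early hT i
      exact ⟨e, he, by rw [hins h hh]⟩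

theorem card_occupied_insert (hT : T.emptyCells.Nonempty) (P : Policy) (i : Fin n) (h : Fin m) :
    (T.insert P i h).occupied.card = T.occupied.card + 1 := by
  obtain ⟨e, he, hins⟩ := exists_insert_item hT P i h
  have : (T.insert P i h).occupied = Insert.insert e T.occupied := by
    ext c
    rw [Finset.mem_insert, mem_occupied, mem_occupied, hins]
    by_cases hc : c = e <;> simp [hc]
  rw [this, Finset.card_insert_of_notMem (by simp [mem_occupied, he])]

/-- The effect on `∑ f (d j)` of incrementing `d` on the set `A` and creating a new value. -/
theorem sum_of_increment (d d' : Fin m → ℕ) (A : Fin m → Prop) [DecidablePred A] (e : Fin m)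
    (f : ℕ → ℝ) (hf : f 0 = 0) (hd : d e = 0) (hA : ¬ A e)
    (h : ∀ j, j ≠ e → d' j = d j + if A j then 1 else 0) :
    ∑ j, f (d' j) = ∑ j, f (d j) + (∑ j, (if A j then f (d j + 1) - f (d j) else 0) + f (d' e)) := by
  have : f (d' e) = ∑ j, if j = e then f (d' e) else 0 := by simp
  rw [this, ← Finset.sum_add_distrib, ← Finset.sum_add_distrib]
  refine Finset.sum_congr rfl fun j _ => ?_
  by_cases hj : j = e
  · subst hj; simp [hd, hA, hf]
  · rw [h j hj]
    by_cases hAj : A j <;> simp [hj, hAj]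

/-! ### The change of the search costs -/

section cost

variable (H : T.Valid) (i : Fin n) (f : ℕ → ℝ) (hf : f 0 = 0)

include H

theorem Valid.chainFrom_eq_of_empty {j : Fin m} (hj : T.item j = none) : T.chainFrom j = [j] :=
  WellLinked.eq_of_empty H hj

theorem Valid.cost_of_empty {j : Fin m} (hj : T.item j = none) : T.cost j = 0 :=
  WellLinked.cost_of_empty H hj

theorem Valid.cost_of_occ {j : Fin m} (hj : T.item j ≠ none) :
    T.cost j = (T.chainFrom j).length :=
  WellLinked.cost_of_occ H hj

include hf

theorem sum_cost_insert_of_empty (P : Policy) {h : Fin m} (hh : T.item h = none) :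
    ∑ j, f ((T.insert P i h).cost j) = ∑ j, f (T.cost j) + f 1 := by
  have H' := WellLinked.store H i h
  rw [insert_of_empty P i hh]
  rw [sum_of_increment T.cost _ (fun _ => False) h f hf (H.cost_of_empty hh) (by simp)]
  · rw [H'.cost_of_occ (by simp), H.chainFrom_eq_of_empty hh]
    simp
  · intro j hj
    by_cases hj' : T.item j = none
    · rw [H'.cost_of_empty (by simpa [hj] using hj'), H.cost_of_empty hj']; simp
    · rw [H'.cost_of_occ (by simpa [hj] using hj'), H.cost_of_occ hj']; simp

/-- The new cell ends its chain, whence the `f 1`; exactly the searches through the old chain end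
gain one cell. -/
theorem sum_cost_insert_late (hT : T.emptyCells.Nonempty) {h : Fin m} (hh : T.item h ≠ none) :
    ∑ j, f ((T.insert .late i h).cost j) = ∑ j, f (T.cost j) +
      (∑ j, (if T.chainEnd h ∈ T.chainFrom j then f (T.cost j + 1) - f (T.cost j) else 0)
        + f 1) := by
  obtain ⟨e, he, hins⟩ := exists_insert_late hT i
  have hε : T.item (T.chainEnd h) ≠ none :=
    WellLinked.mem_occ H (WellLinked.chainEnd_mem H h) hh
  have H' := WellLinked.link_late H i he hε (WellLinked.link_chainEnd H h)
  have hne : T.chainEnd h ∉ T.chainFrom e := by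
    rw [H.chainFrom_eq_of_empty he, List.mem_singleton]
    intro h'; exact hε (h' ▸ he)
  rw [hins h hh]
  rw [sum_of_increment T.cost _ (fun j => T.chainEnd h ∈ T.chainFrom j) e f hf
    (H.cost_of_empty he) hne]
  · rw [H'.cost_of_occ (by simp), if_neg hne, H.chainFrom_eq_of_empty he]
    simp
  · intro j hj
    by_cases hj' : T.item j = none
    · rw [H'.cost_of_empty (by simpa [hj] using hj'), H.cost_of_empty hj', if_neg]
      intro h'; exact WellLinked.occ_of_mem H h' hε hj'
    · rw [H'.cost_of_occ (by simpa [hj] using hj'), H.cost_of_occ hj']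
      split_ifs <;> simp

/-- The new cell takes over everything after `h`, so its cost is the old cost of `h`; exactly the
searches through `h` gain one cell. -/
theorem sum_cost_insert_early (hT : T.emptyCells.Nonempty) {h : Fin m} (hh : T.item h ≠ none) :
    ∑ j, f ((T.insert .early i h).cost j) = ∑ j, f (T.cost j) +
      (∑ j, (if h ∈ T.chainFrom j then f (T.cost j + 1) - f (T.cost j) else 0)
        + f (T.cost h)) := by
  obtain ⟨e, he, hins⟩ := exists_insert_early hT i
  have H' := WellLinked.link_early H i he hh
  have hne : h ∉ T.chainFrom e := by
    rw [H.chainFrom_eq_of_empty he, List.mem_singleton]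
    rintro rfl; exact hh he
  rw [hins h hh]
  rw [sum_of_increment T.cost _ (fun j => h ∈ T.chainFrom j) e f hf (H.cost_of_empty he) hne]
  · rw [H'.cost_of_occ (by simp), if_pos rfl, H.cost_of_occ hh]
    have := WellLinked.length_pos H h
    rw [List.length_cons, List.length_tail, Nat.sub_add_cancel this]
  · intro j hj
    by_cases hj' : T.item j = none
    · rw [H'.cost_of_empty (by simpa [hj] using hj'), H.cost_of_empty hj', if_neg]
      intro h'; exact WellLinked.occ_of_mem H h' hh hj'
    · rw [H'.cost_of_occ (by simpa [hj] using hj'), H.cost_of_occ hj', if_neg hj,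
        length_insertAfter (WellLinked.nodup H j)]

omit hf in
/-- The number of cells from which an insertion affects the search from `j`. -/
theorem sum_occupied_mem_chainFrom (g : Fin m → ℝ) :
    ∑ c ∈ T.occupied, ∑ j, (if c ∈ T.chainFrom j then g j else 0) = ∑ j, T.cost j * g j := by
  rw [Finset.sum_comm]
  refine Finset.sum_congr rfl fun j _ => ?_
  rw [← Finset.sum_filter, Finset.sum_const, nsmul_eq_mul]
  congr 2
  by_cases hj : T.item j = none
  · rw [H.cost_of_empty hj, Finset.card_eq_zero, Finset.filter_eq_empty_iff]
    intro c hc h'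
    exact WellLinked.occ_of_mem H h' (mem_occupied.1 hc) hj
  · rw [H.cost_of_occ hj, ← List.toFinset_card_of_nodup (WellLinked.nodup H j)]
    congr 1
    ext c
    simp only [Finset.mem_filter, mem_occupied, List.mem_toFinset, and_iff_right_iff_imp]
    exact fun hc => WellLinked.mem_occ H hc hj

theorem sum_occupied_cost : ∑ c ∈ T.occupied, f (T.cost c) = ∑ c, f (T.cost c) := by
  refine Finset.sum_subset (Finset.subset_univ _) fun c _ hc => ?_
  rw [mem_occupied, not_not] at hc
  rw [H.cost_of_empty hc, hf]

omit hf in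
/-- Summing along the chain from an occupied cell. -/
theorem sum_mem_chainFrom {h : Fin m} (hh : T.item h ≠ none) :
    ∑ j, (if j ∈ T.chainFrom h then f (T.cost j + 1) - f (T.cost j) else 0)
      = f (T.cost h + 1) - f 1 := by
  rw [← Finset.sum_filter]
  have : (Finset.univ.filter fun j => j ∈ T.chainFrom h) = (T.chainFrom h).toFinset := by
    ext; simp
  rw [this, List.sum_toFinset _ (WellLinked.nodup H h)]
  have h2 : ((T.chainFrom h).map fun j => f (T.cost j + 1) - f (T.cost j)) =
      (T.chainFrom h).map fun j => f ((T.chainFrom j).length + 1) - f (T.chainFrom j).length := by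
    refine List.map_congr_left fun j hj => ?_
    rw [H.cost_of_occ (WellLinked.mem_occ H hj hh)]
  rw [h2, WellLinked.sum_length H (fun l => f (l + 1) - f l), H.cost_of_occ hh]
  exact Finset.sum_range_sub (fun l => f (l + 1)) _

/-- The total of `f (cost)` after an insertion, summed over all hash addresses. -/
theorem sum_sum_cost_insert (P : Policy) (hT : T.emptyCells.Nonempty) :
    ∑ c, ∑ j, f ((T.insert P i c).cost j) =
      m * ∑ j, f (T.cost j) + (m - T.occupied.card) * f 1 +
        ∑ j, (T.cost j * (f (T.cost j + 1) - f (T.cost j)) + f (T.cost j)) := by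
  -- `R c` is the increase caused by the occupied address `c`. Empty addresses contribute `f 1` each
  -- under both policies, so only the sum of `R` has to be found.
  suffices h : ∃ R : Fin m → ℝ, (∀ c, T.item c ≠ none →
      ∑ j, f ((T.insert P i c).cost j) = ∑ j, f (T.cost j) + R c) ∧
      ∑ c ∈ T.occupied, R c =
        ∑ j, (T.cost j * (f (T.cost j + 1) - f (T.cost j)) + f (T.cost j)) by
    obtain ⟨R, hR, hsum⟩ := h
    have h1 : ∀ c, ∑ j, f ((T.insert P i c).cost j) =
        ∑ j, f (T.cost j) + if T.item c ≠ none then R c else f 1 := by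
      intro c
      by_cases hc : T.item c = none
      · rw [sum_cost_insert_of_empty H i f hf P hc, if_neg (by simpa using hc)]
      · rw [hR c hc, if_pos hc]
    have hcard : (T.emptyCells.card : ℝ) = m - T.occupied.card := by
      rw [eq_sub_iff_add_eq]; exact_mod_cast T.card_emptyCells_add_card_occupied
    have hempty : Finset.univ.filter (fun c => ¬ T.item c ≠ none) = T.emptyCells := by
      simp [emptyCells]
    rw [Finset.sum_congr rfl fun c _ => h1 c, Finset.sum_add_distrib, Finset.sum_const,
      Finset.card_univ, Fintype.card_fin, nsmul_eq_mul, Finset.sum_ite, hempty, Finset.sum_const,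
      nsmul_eq_mul, hcard, ← hsum]
    unfold occupied
    ring
  cases P with
  | early =>
    -- Double counting: the search from `j` passes `cost j` occupied cells, hence is prolonged by
    -- that many addresses.
    refine ⟨_, fun c hc => sum_cost_insert_early H i f hf hT hc, ?_⟩
    rw [Finset.sum_add_distrib, sum_occupied_mem_chainFrom H, sum_occupied_cost H f hf,
      ← Finset.sum_add_distrib]
  | late =>
    refine ⟨_, fun c hc => sum_cost_insert_late H i f hf hT hc, ?_⟩
    rw [Finset.sum_add_distrib (f := fun j => (T.cost j : ℝ) * (f (T.cost j + 1) - f (T.cost j))),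
      ← sum_occupied_mem_chainFrom H, ← sum_occupied_cost H f hf, ← Finset.sum_add_distrib]
    refine Finset.sum_congr rfl fun c hc => ?_
    rw [mem_occupied] at hc
    -- Inclusion–exclusion over cells before and after `c`, with `c` itself counted twice. The sum
    -- over the cells from `c` on telescopes, and with the term `f 1` the increase becomes the one
    -- of early insertion, for each `c` separately.
    have h1 : ∀ j, (if T.chainEnd c ∈ T.chainFrom j then f (T.cost j + 1) - f (T.cost j) else 0) =
        (if c ∈ T.chainFrom j then f (T.cost j + 1) - f (T.cost j) else 0) +
        (if j ∈ T.chainFrom c then f (T.cost j + 1) - f (T.cost j) else 0) -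
        (if j = c then f (T.cost j + 1) - f (T.cost j) else 0) := by
      intro j
      have hiff := WellLinked.chainEnd_mem_iff H c j
      by_cases hj : j = c
      · subst hj
        have := WellLinked.mem_self H j
        rw [if_pos (hiff.2 (Or.inl this)), if_pos this, if_pos rfl]; ring
      · by_cases h2 : j ∈ T.chainFrom c
        · have h3 : c ∉ T.chainFrom j := fun h3 => hj (WellLinked.antisymm H h3 h2)
          rw [if_pos (hiff.2 (Or.inl h2)), if_pos h2, if_neg h3, if_neg hj]; ring
        · by_cases h3 : c ∈ T.chainFrom j
          · rw [if_pos (hiff.2 (Or.inr h3)), if_pos h3, if_neg h2, if_neg hj]; ring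
          · rw [if_neg (by rw [hiff]; tauto), if_neg h3, if_neg h2, if_neg hj]; ring
    rw [Finset.sum_congr rfl fun j _ => h1 j, Finset.sum_sub_distrib, Finset.sum_add_distrib,
      sum_mem_chainFrom H f hc, Finset.sum_ite_eq' Finset.univ c]
    simp only [Finset.mem_univ, if_true]
    ring

end cost

/-- The number of links to follow from the cell `a` until item `i` is found. -/
def disp (T : Table m n) (a : Fin m) (i : Fin n) : ℕ :=
  (T.chainFrom a).findIdx fun c => decide (T.item c = some i)

/-- Item `i` is stored in the cell `x`, and only there, and it is found from `a`. -/
structure FoundAt (T : Table m n) (a : Fin m) (i : Fin n) (x : Fin m) : Prop where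
  mem : x ∈ T.chainFrom a
  item_iff : ∀ c, T.item c = some i ↔ c = x

theorem FoundAt.disp_eq {a x : Fin m} {i : Fin n} (h : T.FoundAt a i x) :
    T.disp a i = (T.chainFrom a).idxOf x := by
  rw [disp, List.idxOf]
  congr 1
  ext c
  rw [Bool.eq_iff_iff]
  simp [h.item_iff]

/-! ### The change of the displacements -/

section disp

variable (H : T.Valid) (hT : T.emptyCells.Nonempty) {i i' : Fin n} {a x : Fin m}

include H

theorem foundAt_insert_of_empty (P : Policy) (hx : T.FoundAt a i x) (hi : i ≠ i') {c : Fin m}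
    (hc : T.item c = none) :
    (T.insert P i' c).FoundAt a i x ∧ (T.insert P i' c).disp a i = T.disp a i := by
  have H' := (WellLinked.store H i' c).chainFrom_eq_fun
  rw [insert_of_empty P i' hc]
  have h1 : FoundAt { T with item := Function.update T.item c (some i') } a i x := by
    refine ⟨by rw [H']; exact hx.mem, fun d => ?_⟩
    by_cases hd : d = c
    · subst hd
      have := hx.item_iff d
      simp [hc] at this
      simp [hi.symm, this]
    · simpa [hd] using hx.item_iff d
  exact ⟨h1, by rw [h1.disp_eq, hx.disp_eq, H']⟩

include hT

/-- Late insertion only appends to chains, so the position of a cell already present does not move.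
-/
theorem foundAt_insert_late (hx : T.FoundAt a i x) (hi : i ≠ i') {c : Fin m}
    (hc : T.item c ≠ none) :
    (T.insert .late i' c).FoundAt a i x ∧ (T.insert .late i' c).disp a i = T.disp a i := by
  obtain ⟨e, he, hins⟩ := exists_insert_late hT i'
  have H' := (WellLinked.link_late H i' he (WellLinked.mem_occ H (WellLinked.chainEnd_mem H c) hc)
    (WellLinked.link_chainEnd H c)).chainFrom_eq
  rw [← hins c hc] at H'
  have h1 : (T.insert .late i' c).FoundAt a i x := by
    refine ⟨?_, fun d => ?_⟩
    · rw [H']; split_ifs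
      · exact List.mem_append_left _ hx.mem
      · exact hx.mem
    · rw [hins c hc]
      by_cases hd : d = e
      · subst hd
        have := hx.item_iff d
        simp [he] at this
        simp [hi.symm, this]
      · simpa [hd] using hx.item_iff d
  refine ⟨h1, ?_⟩
  rw [h1.disp_eq, hx.disp_eq, H']
  split_ifs
  · exact List.idxOf_append_of_mem hx.mem
  · rfl

theorem foundAt_insert_early (hx : T.FoundAt a i x) (hi : i ≠ i') {c : Fin m}
    (hc : T.item c ≠ none) :
    (T.insert .early i' c).FoundAt a i x ∧ (T.insert .early i' c).disp a i =
      T.disp a i + if c ∈ (T.chainFrom a).take (T.disp a i) then 1 else 0 := by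
  obtain ⟨e, he, hins⟩ := exists_insert_early hT i'
  have H' := (WellLinked.link_early H i' he hc).chainFrom_eq
  rw [← hins c hc] at H'
  have hxe : x ≠ e := by
    rintro rfl
    have := (hx.item_iff x).2 rfl
    rw [he] at this; cases this
  have hae : a ≠ e := by
    rintro rfl
    have := hx.mem
    rw [H.chainFrom_eq_of_empty he, List.mem_singleton] at this
    exact hxe this
  have h1 : (T.insert .early i' c).FoundAt a i x := by
    refine ⟨?_, fun d => ?_⟩
    · rw [H', if_neg hae, mem_insertAfter]
      exact Or.inl hx.mem
    · rw [hins c hc]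
      by_cases hd : d = e
      · subst hd
        simp [hi.symm, hxe.symm]
      · simpa [hd] using hx.item_iff d
  refine ⟨h1, ?_⟩
  rw [h1.disp_eq, hx.disp_eq, H', if_neg hae, idxOf_insertAfter (WellLinked.nodup H a) hxe]

theorem FoundAt.insert (P : Policy) (hx : T.FoundAt a i x) (hi : i ≠ i') (c : Fin m) :
    (T.insert P i' c).FoundAt a i x := by
  by_cases hc : T.item c = none
  · exact (foundAt_insert_of_empty H P hx hi hc).1
  · cases P with
    | late => exact (foundAt_insert_late H hT hx hi hc).1
    | early => exact (foundAt_insert_early H hT hx hi hc).1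

theorem disp_insert_late (hx : T.FoundAt a i x) (hi : i ≠ i') (c : Fin m) :
    (T.insert .late i' c).disp a i = T.disp a i := by
  by_cases hc : T.item c = none
  · exact (foundAt_insert_of_empty H .late hx hi hc).2
  · exact (foundAt_insert_late H hT hx hi hc).2

theorem disp_insert_early (hx : T.FoundAt a i x) (hi : i ≠ i') (c : Fin m) :
    (T.insert .early i' c).disp a i =
      T.disp a i + if c ∈ (T.chainFrom a).take (T.disp a i) then 1 else 0 := by
  by_cases hc : T.item c = none
  · rw [(foundAt_insert_of_empty H .early hx hi hc).2, if_neg, add_zero]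
    -- Every cell on the way to a stored item is occupied, so an empty address cannot lie there.
    intro h'
    have hx' : T.item x ≠ none := by rw [(hx.item_iff x).2 rfl]; simp
    exact WellLinked.mem_occ H (List.mem_of_mem_take h') (WellLinked.occ_of_mem H hx.mem hx') hc
  · exact (foundAt_insert_early H hT hx hi hc).2

/-- The addresses that push the item back are the cells strictly before it on its search path, and
these number exactly its displacement. -/
theorem sum_disp_insert_early (hx : T.FoundAt a i x) (hi : i ≠ i') (f : ℕ → ℝ) :
    ∑ c, f ((T.insert .early i' c).disp a i) =
      m * f (T.disp a i) + T.disp a i * (f (T.disp a i + 1) - f (T.disp a i)) := by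
  have h1 : ∀ c, f ((T.insert .early i' c).disp a i) = f (T.disp a i) +
      if c ∈ (T.chainFrom a).take (T.disp a i) then f (T.disp a i + 1) - f (T.disp a i)
        else 0 := by
    intro c
    rw [disp_insert_early H hT hx hi c]
    split_ifs <;> simp
  rw [Finset.sum_congr rfl fun c _ => h1 c, Finset.sum_add_distrib, ← Finset.sum_filter]
  have h2 : (Finset.univ.filter fun c => c ∈ (T.chainFrom a).take (T.disp a i)) =
      ((T.chainFrom a).take (T.disp a i)).toFinset := by ext; simp
  have h3 : T.disp a i ≤ (T.chainFrom a).length := by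
    rw [hx.disp_eq]; exact List.idxOf_le_length
  rw [h2, Finset.sum_const, Finset.sum_const, List.toFinset_card_of_nodup
    ((WellLinked.nodup H a).sublist (List.take_sublist _ _)), List.length_take, min_eq_left h3]
  simp

/-- The new item is found, and its displacement is the length of the path to it. -/
theorem exists_foundAt_insert_self (hi : ∀ c, T.item c ≠ some i) (P : Policy) (c : Fin m) :
    (∃ x, (T.insert P i c).FoundAt c i x) ∧ (T.insert P i c).disp c i =
      match P with
      | .late => T.cost c
      | .early => if T.item c = none then 0 else 1 := by
  have hup : ∀ e d, Function.update T.item e (some i) d = some i ↔ d = e := by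
    intro e d
    by_cases hd : d = e <;> simp [hd, hi d]
  by_cases hc : T.item c = none
  · have H' := (WellLinked.store H i c).chainFrom_eq_fun
    have h1 : (T.insert P i c).FoundAt c i c := by
      rw [insert_of_empty P i hc]
      exact ⟨by rw [H']; exact WellLinked.mem_self H c, hup c⟩
    refine ⟨⟨c, h1⟩, ?_⟩
    have h2 : (T.insert P i c).disp c i = 0 := by
      rw [h1.disp_eq, insert_of_empty P i hc, H', H.chainFrom_eq_of_empty hc]
      simp
    rw [h2]
    cases P with
    | late => exact (H.cost_of_empty hc).symm
    | early => simp [hc]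
  · cases P with
    | late =>
      obtain ⟨e, he, hins⟩ := exists_insert_late hT i
      have hce : c ≠ e := by rintro rfl; exact hc he
      have H' := (WellLinked.link_late H i he
        (WellLinked.mem_occ H (WellLinked.chainEnd_mem H c) hc)
        (WellLinked.link_chainEnd H c)).chainFrom_eq
      rw [← hins c hc] at H'
      have hch : (T.insert .late i c).chainFrom c = T.chainFrom c ++ [e] := by
        rw [H', if_pos (WellLinked.chainEnd_mem H c)]
      have h1 : (T.insert .late i c).FoundAt c i e := by
        refine ⟨by rw [hch]; simp, ?_⟩
        rw [hins c hc]; exact hup e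
      refine ⟨⟨e, h1⟩, ?_⟩
      rw [h1.disp_eq, hch, List.idxOf_append_of_notMem (WellLinked.not_mem_of_empty H he hce)]
      simp [H.cost_of_occ hc]
    | early =>
      obtain ⟨e, he, hins⟩ := exists_insert_early hT i
      have hce : c ≠ e := by rintro rfl; exact hc he
      have H' := (WellLinked.link_early H i he hc).chainFrom_eq
      rw [← hins c hc] at H'
      have hch : ∃ l, (T.insert .early i c).chainFrom c = c :: e :: l := by
        rw [H', if_neg hce, WellLinked.unfold H]
        simp [insertAfter]
      obtain ⟨l, hch⟩ := hch
      have h1 : (T.insert .early i c).FoundAt c i e := by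
        refine ⟨by rw [hch]; simp, ?_⟩
        rw [hins c hc]; exact hup e
      refine ⟨⟨e, h1⟩, ?_⟩
      rw [h1.disp_eq, hch, List.idxOf_cons_ne _ hce]
      simp [hc]

end disp

end Table

/-! ### The table after `k` insertions -/

variable {m n : ℕ}

/-- The table after the insertion of the first `k` items. -/
def stage (P : Policy) (h : Fin n → Fin m) (k : ℕ) : Table m n :=
  ((List.finRange n).take k).foldl (fun T i => T.insert P i (h i)) (Table.init m n)

theorem stage_zero (P : Policy) (h : Fin n → Fin m) : stage P h 0 = Table.init m n := by
  simp [stage]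

theorem stage_succ (P : Policy) (h : Fin n → Fin m) (k : Fin n) :
    stage P h (k + 1) = (stage P h k).insert P k (h k) := by
  have : (List.finRange n).take (k + 1) = (List.finRange n).take k ++ [k] := by
    rw [List.take_add_one, List.getElem?_eq_getElem (by simp)]
    simp
  rw [stage, this, List.foldl_append]
  rfl

theorem stage_last (P : Policy) (h : Fin n → Fin m) : stage P h n = Table.build P h := by
  rw [stage, List.take_of_length_le (by simp), Table.build]

/-- The combinatorial form of independence: the table before the insertion of item `i` does not
depend on the address of `i`. -/
theorem stage_update (P : Policy) (h : Fin n → Fin m) (i : Fin n) (c : Fin m) {k : ℕ}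
    (hk : k ≤ i) : stage P (Function.update h i c) k = stage P h k := by
  induction k with
  | zero => rw [stage_zero, stage_zero]
  | succ k ih =>
    have hki : (⟨k, by omega⟩ : Fin n) ≠ i := by
      intro h'; rw [← h'] at hk; simp at hk
    have := stage_succ P h ⟨k, by omega⟩
    have h2 := stage_succ P (Function.update h i c) ⟨k, by omega⟩
    simp only [Function.update_of_ne hki] at this h2
    rw [this, h2, ih (by omega)]

/-- What is known about the table after `k` insertions. -/
structure StageInvariant (P : Policy) (h : Fin n → Fin m) (k : ℕ) : Prop where
  valid : (stage P h k).Valid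
  card_occupied : (stage P h k).occupied.card = k
  item_lt : ∀ c i, (stage P h k).item c = some i → (i : ℕ) < k
  found : ∀ i : Fin n, (i : ℕ) < k → ∃ x, (stage P h k).FoundAt (h i) i x

theorem StageInvariant.emptyCells_nonempty {P : Policy} {h : Fin n → Fin m} {k : ℕ}
    (H : StageInvariant P h k) (hk : k < m) : (stage P h k).emptyCells.Nonempty :=
  Table.emptyCells_nonempty (by rwa [H.card_occupied])

theorem stageInvariant (hnm : n ≤ m) (P : Policy) (h : Fin n → Fin m) {k : ℕ} (hk : k ≤ n) :
    StageInvariant P h k := by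
  induction k with
  | zero =>
    constructor
    · rw [stage_zero]; exact Table.valid_init m n
    · simp [stage_zero, Table.occupied, Table.init]
    · simp [stage_zero, Table.init]
    · simp
  | succ k ih =>
    have hkn : k < n := hk
    have H := ih hkn.le
    have hT := H.emptyCells_nonempty (by omega)
    have hs := stage_succ P h ⟨k, hkn⟩
    simp only at hs
    obtain ⟨e, he, hitem⟩ := Table.exists_insert_item hT P ⟨k, hkn⟩ (h ⟨k, hkn⟩)
    constructor
    · rw [hs]; exact H.valid.insert hT _ _ _
    · rw [hs, Table.card_occupied_insert hT, H.card_occupied]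
    · intro c i hc
      rw [hs, hitem] at hc
      by_cases hce : c = e
      · simp [hce] at hc; rw [← hc]; simp
      · rw [Function.update_of_ne hce] at hc
        have := H.item_lt c i hc; omega
    · intro i hi
      rw [hs]
      by_cases hik : i = ⟨k, hkn⟩
      · subst hik
        exact (Table.exists_foundAt_insert_self H.valid hT
          (fun c hc => absurd (H.item_lt c _ hc) (by simp)) P _).1
      · have hik' : (i : ℕ) < k := by
          have : (i : ℕ) ≠ k := fun h' => hik (Fin.ext h')
          omega
        obtain ⟨x, hx⟩ := H.found i hik'
        exact ⟨x, hx.insert H.valid hT P hik _⟩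

/-- A uniform hash address that is independent of the rest. -/
theorem sum_sum_eq_mul_sum (k : Fin n) (G : (Fin n → Fin m) → Fin m → ℝ)
    (hG : ∀ h c x, G (Function.update h k c) x = G h x) :
    ∑ h, ∑ c, G h c = m * ∑ h, G h (h k) := by
  have h1 : ∑ h, ∑ c : Fin m, G h (h k) = m * ∑ h, G h (h k) := by
    simp [Finset.mul_sum]
  rw [← h1, ← Fintype.sum_prod_type', ← Fintype.sum_prod_type']
  -- The involution exchanges the `k`-th address with the additional address `c`.
  refine Fintype.sum_equiv
    (Equiv.mk (fun p => (Function.update p.1 k p.2, p.1 k))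
      (fun p => (Function.update p.1 k p.2, p.1 k)) (fun p => by simp) (fun p => by simp)) _ _ ?_
  rintro ⟨h, c⟩
  simp [hG]

/-! ### Unsuccessful searches -/

/-- The sum of `f (cost)` over all hash sequences and all addresses, after `k` insertions. -/
noncomputable def totalCost (P : Policy) (m n : ℕ) (f : ℕ → ℝ) (k : ℕ) : ℝ :=
  ∑ h : Fin n → Fin m, ∑ j, f ((stage P h k).cost j)

/-- The hypothesis `hκ` says that `f` is an eigenfunction of the mean increment, so that the
recurrence involves no other functional. It is used with `f d = d`, `κ = 2` and with `f d = d * (d +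
1)`, `κ = 3`. -/
theorem totalCost_succ (hnm : n ≤ m) (P : Policy) {f : ℕ → ℝ} (hf : f 0 = 0) {κ : ℝ}
    (hκ : ∀ d : ℕ, d * (f (d + 1) - f d) + f d = κ * f d) {k : ℕ} (hk : k < n) :
    m * totalCost P m n f (k + 1) =
      (m + κ) * totalCost P m n f k + (m : ℝ) ^ n * ((m - k) * f 1) := by
  have h1 : totalCost P m n f (k + 1) = ∑ h : Fin n → Fin m,
      ∑ j, f (((stage P h k).insert P ⟨k, hk⟩ (h ⟨k, hk⟩)).cost j) := by
    refine Finset.sum_congr rfl fun h _ => ?_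
    have := stage_succ P h ⟨k, hk⟩
    simp only at this
    rw [this]
  have h0 := sum_sum_eq_mul_sum (m := m) ⟨k, hk⟩
    (fun h c => ∑ j, f (((stage P h k).insert P ⟨k, hk⟩ c).cost j)) (by
      intro h c x; simp only [stage_update P h ⟨k, hk⟩ c le_rfl])
  rw [h1, ← h0]
  have h2 : ∀ h : Fin n → Fin m,
      ∑ c, ∑ j, f (((stage P h k).insert P ⟨k, hk⟩ c).cost j) =
        (m + κ) * (∑ j, f ((stage P h k).cost j)) + (m - k) * f 1 := by
    intro h
    have H := stageInvariant hnm P h hk.le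
    rw [Table.sum_sum_cost_insert H.valid _ f hf P (H.emptyCells_nonempty (by omega)),
      H.card_occupied, Finset.sum_congr rfl fun j _ => hκ _, ← Finset.mul_sum]
    ring
  simp only [h2, Finset.sum_add_distrib, ← Finset.mul_sum, totalCost, Finset.sum_const,
    Finset.card_univ, Fintype.card_pi, Fintype.card_fin, Finset.prod_const, nsmul_eq_mul]
  push_cast
  ring

/-- After division by `m ^ n * m` the recurrence has an inhomogeneity affine in `k`; the solution is
a multiple of `(1 + κ / m) ^ k` plus an affine function of `k`, vanishing at `k = 0`. -/
theorem totalCost_eq (hm : 0 < m) (hnm : n ≤ m) (P : Policy) {f : ℕ → ℝ} (hf : f 0 = 0) {κ : ℝ}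
    (hκ0 : κ ≠ 0) (hκ : ∀ d : ℕ, d * (f (d + 1) - f d) + f d = κ * f d) {k : ℕ} (hk : k ≤ n) :
    totalCost P m n f k = (m : ℝ) ^ n * m *
      (f 1 / κ ^ 2 * ((κ - 1) * ((1 + κ / m) ^ k - 1) + κ * (k / m))) := by
  have hm' : (m : ℝ) ≠ 0 := by positivity
  induction k with
  | zero => simp [totalCost, stage_zero, Table.cost, Table.init, hf]
  | succ k ih =>
    have h1 := totalCost_succ hnm P hf hκ (k := k) (by omega)
    rw [ih (by omega)] at h1
    rw [← mul_right_inj' hm', h1]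
    push_cast
    rw [pow_succ (1 + κ / (m : ℝ)) k]
    field_simp
    ring

/-! ### Displacements under late insertion -/

/-- A displacement is fixed when the item is stored: it is then the number of occupied cells that
the preceding search from its address meets. -/
theorem disp_stage_late (hnm : n ≤ m) (h : Fin n → Fin m) (i : Fin n) {k : ℕ} (hk : k ≤ n)
    (hik : (i : ℕ) < k) :
    (stage .late h k).disp (h i) i = (stage .late h i).cost (h i) := by
  induction k with
  | zero => omega
  | succ k ih =>
    have hkn : k < n := hk
    have H := stageInvariant hnm .late h (k := k) (by omega)
    have hT := H.emptyCells_nonempty (by omega)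
    have hs := stage_succ .late h ⟨k, hkn⟩
    simp only at hs
    rw [hs]
    by_cases hi : i = ⟨k, hkn⟩
    · subst hi
      exact (Table.exists_foundAt_insert_self H.valid hT
          (fun c hc => absurd (H.item_lt c _ hc) (by simp)) .late _).2
    · have hik' : (i : ℕ) < k := by
        have : (i : ℕ) ≠ k := fun h' => hi (Fin.ext h')
        omega
      obtain ⟨x, hx⟩ := H.found i hik'
      rw [Table.disp_insert_late H.valid hT hx hi, ih (by omega) hik']

theorem sum_displacement_late (hm : 0 < m) (hnm : n ≤ m) {f : ℕ → ℝ} (hf : f 0 = 0) {κ : ℝ}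
    (hκ0 : κ ≠ 0) (hκ : ∀ d : ℕ, d * (f (d + 1) - f d) + f d = κ * f d) :
    ∑ h : Fin n → Fin m, ∑ i, f (displacement .late h i) = (m : ℝ) ^ n *
      (f 1 / κ ^ 2 * ((κ - 1) * (((1 + κ / m) ^ n - 1) * (m / κ) - n)
        + κ * (n * (n - 1) / (2 * m)))) := by
  have hm' : (m : ℝ) ≠ 0 := by positivity
  have h1 : ∀ i : Fin n, ∑ h : Fin n → Fin m, f (displacement .late h i) =
      (m : ℝ) ^ n * (f 1 / κ ^ 2 * ((κ - 1) * ((1 + κ / m) ^ (i : ℕ) - 1) + κ * (i / m))) := by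
    intro i
    -- The address of item `i` is uniform and independent of the table before it, so it may be
    -- replaced by a free address `c`, as in `totalCost`.
    have h2 := sum_sum_eq_mul_sum (m := m) i (fun h c => f ((stage .late h i).cost c)) (by
      intro h c x; simp only [stage_update .late h i c le_rfl])
    have h3 := totalCost_eq hm hnm .late hf hκ0 hκ i.2.le
    rw [totalCost, h2] at h3
    rw [← mul_right_inj' hm']
    convert h3 using 1
    · congr 1
      refine Finset.sum_congr rfl fun h _ => ?_
      rw [← disp_stage_late hnm h i le_rfl i.2, stage_last]
      rfl
    · ring
  rw [Finset.sum_comm, Finset.sum_congr rfl fun i _ => h1 i, ← Finset.mul_sum, ← Finset.mul_sum,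
    Finset.sum_add_distrib, ← Finset.mul_sum, ← Finset.mul_sum, Finset.sum_sub_distrib,
    Fin.sum_univ_eq_sum_range (fun i => (1 + κ / (m : ℝ)) ^ i), geom_sum_eq (by
      simpa using ⟨hκ0, by omega⟩),
    Fin.sum_univ_eq_sum_range (fun i => (i : ℝ) / m), ← Finset.sum_div]
  have h4 : ∑ i ∈ Finset.range n, (i : ℝ) = n * (n - 1) / 2 := by
    clear * -
    induction n with
    | zero => simp
    | succ n ih => rw [Finset.sum_range_succ, ih]; push_cast; ring
  rw [h4]
  simp only [Finset.sum_const, Finset.card_univ, Fintype.card_fin, nsmul_eq_mul, mul_one,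
    add_sub_cancel_left]
  field_simp

/-! ### Displacements under early insertion -/

/-- The sum of `f (displacement)` over all hash sequences and the first `k` items, after `k`
insertions. -/
noncomputable def totalDisp (m n : ℕ) (f : ℕ → ℝ) (k : ℕ) : ℝ :=
  ∑ h : Fin n → Fin m, ∑ i ∈ Finset.univ.filter (fun i : Fin n => (i : ℕ) < k), f ((stage .early h k).disp (h i) i)

/-- The new item contributes `f 1` for each of the `k` occupied addresses and 0 otherwise. For the
old items `hκ` closes the recurrence; it holds for `f d = d`, `κ = 1` and for `f d = d * (d + 1)`,
`κ = 2`. -/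
theorem totalDisp_succ (hnm : n ≤ m) {f : ℕ → ℝ} (hf : f 0 = 0) {κ : ℝ}
    (hκ : ∀ d : ℕ, d * (f (d + 1) - f d) = κ * f d) {k : ℕ} (hk : k < n) :
    m * totalDisp m n f (k + 1) =
      (m + κ) * totalDisp m n f k + (m : ℝ) ^ n * (k * f 1) := by
  have hfilter : (Finset.univ.filter fun i : Fin n => (i : ℕ) < k + 1) =
      insert ⟨k, hk⟩ (Finset.univ.filter fun i : Fin n => (i : ℕ) < k) := by
    ext i
    simp only [Finset.mem_filter, Finset.mem_univ, true_and, Finset.mem_insert, Fin.ext_iff]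
    omega
  have hne : ∀ {i : Fin n}, (i : ℕ) < k → i ≠ ⟨k, hk⟩ := by
    rintro i hi rfl; simp at hi
  have h1 : totalDisp m n f (k + 1) = ∑ h : Fin n → Fin m,
      ((if (stage .early h k).item (h ⟨k, hk⟩) = none then 0 else f 1) +
        ∑ i ∈ Finset.univ.filter (fun i : Fin n => (i : ℕ) < k),
          f (((stage .early h k).insert .early ⟨k, hk⟩ (h ⟨k, hk⟩)).disp (h i) i)) := by
    refine Finset.sum_congr rfl fun h _ => ?_
    have H := stageInvariant hnm .early h hk.le
    have hT := H.emptyCells_nonempty (by omega)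
    have hs := stage_succ .early h ⟨k, hk⟩
    simp only at hs
    rw [hs, hfilter, Finset.sum_insert (by simp), (Table.exists_foundAt_insert_self H.valid hT
          (fun c hc => absurd (H.item_lt c _ hc) (by simp)) .early _).2]
    split_ifs <;> simp [hf]
  have h0 := sum_sum_eq_mul_sum (m := m) ⟨k, hk⟩
    (fun h c => (if (stage .early h k).item c = none then 0 else f 1) +
        ∑ i ∈ Finset.univ.filter (fun i : Fin n => (i : ℕ) < k),
          f (((stage .early h k).insert .early ⟨k, hk⟩ c).disp (h i) i)) (by
      intro h c x
      simp only [stage_update .early h ⟨k, hk⟩ c le_rfl]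
      congr 1
      refine Finset.sum_congr rfl fun i hi => ?_
      rw [Function.update_of_ne (hne (Finset.mem_filter.1 hi).2)])
  rw [h1, ← h0]
  have h2 : ∀ h : Fin n → Fin m,
      ∑ c, ((if (stage .early h k).item c = none then 0 else f 1) +
        ∑ i ∈ Finset.univ.filter (fun i : Fin n => (i : ℕ) < k),
          f (((stage .early h k).insert .early ⟨k, hk⟩ c).disp (h i) i)) =
        (m + κ) * (∑ i ∈ Finset.univ.filter (fun i : Fin n => (i : ℕ) < k), f ((stage .early h k).disp (h i) i)) +
          k * f 1 := by
    intro h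
    have H := stageInvariant hnm .early h hk.le
    have hT := H.emptyCells_nonempty (by omega)
    have h3 : ∑ c, (if (stage .early h k).item c = none then 0 else f 1) = k * f 1 := by
      rw [Finset.sum_ite, Finset.sum_const_zero, zero_add, Finset.sum_const, nsmul_eq_mul]
      congr 2
      exact H.card_occupied
    rw [Finset.sum_add_distrib, h3, Finset.sum_comm, Finset.mul_sum, add_comm]
    congr 1
    refine Finset.sum_congr rfl fun i hi => ?_
    have hi' := (Finset.mem_filter.1 hi).2
    obtain ⟨x, hx⟩ := H.found i hi'
    rw [Table.sum_disp_insert_early H.valid hT hx (hne hi'), hκ]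
    ring
  simp only [h2, Finset.sum_add_distrib, ← Finset.mul_sum, totalDisp, Finset.sum_const,
    Finset.card_univ, Fintype.card_pi, Fintype.card_fin, Finset.prod_const, nsmul_eq_mul]
  push_cast
  ring

theorem totalDisp_eq (hm : 0 < m) (hnm : n ≤ m) {f : ℕ → ℝ} (hf : f 0 = 0) {κ : ℝ}
    (hκ0 : κ ≠ 0) (hκ : ∀ d : ℕ, d * (f (d + 1) - f d) = κ * f d) {k : ℕ} (hk : k ≤ n) :
    totalDisp m n f k = (m : ℝ) ^ n * (f 1 / κ * (((1 + κ / m) ^ k - 1) * (m / κ) - k)) := by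
  have hm' : (m : ℝ) ≠ 0 := by positivity
  induction k with
  | zero => simp [totalDisp]
  | succ k ih =>
    have h1 := totalDisp_succ hnm hf hκ (k := k) (by omega)
    rw [ih (by omega)] at h1
    rw [← mul_right_inj' hm', h1]
    push_cast
    rw [pow_succ (1 + κ / (m : ℝ)) k]
    field_simp
    ring

theorem sum_displacement_early (hm : 0 < m) (hnm : n ≤ m) {f : ℕ → ℝ} (hf : f 0 = 0) {κ : ℝ}
    (hκ0 : κ ≠ 0) (hκ : ∀ d : ℕ, d * (f (d + 1) - f d) = κ * f d) :
    ∑ h : Fin n → Fin m, ∑ i, f (displacement .early h i) =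
      (m : ℝ) ^ n * (f 1 / κ * (((1 + κ / m) ^ n - 1) * (m / κ) - n)) := by
  rw [← totalDisp_eq hm hnm hf hκ0 hκ le_rfl, totalDisp]
  refine Finset.sum_congr rfl fun h _ => ?_
  rw [stage_last]
  simp only [Fin.is_lt, Finset.filter_true]
  rfl

/-! ### Unsuccessful searches in the final table -/

theorem sum_unsuccessfulCost (hm : 0 < m) (hnm : n ≤ m) (P : Policy) {f : ℕ → ℝ} (hf : f 0 = 0)
    {κ : ℝ} (hκ0 : κ ≠ 0) (hκ : ∀ d : ℕ, d * (f (d + 1) - f d) + f d = κ * f d) :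
    ∑ h : Fin n → Fin m, ∑ j, f (unsuccessfulCost P h j) = (m : ℝ) ^ n * m *
      (f 1 / κ ^ 2 * ((κ - 1) * ((1 + κ / m) ^ n - 1) + κ * (n / m))) := by
  rw [← totalCost_eq hm hnm P hf hκ0 hκ le_rfl, totalCost]
  simp only [stage_last]
  rfl

/-- A search has cost 0 exactly at an empty cell, and `m - n` cells are empty whatever the
addresses. This is the correction from cost to number of probes. -/
theorem sum_unsuccessfulCost_eq_zero (hnm : n ≤ m) (P : Policy) :
    ∑ h : Fin n → Fin m, ∑ j, (if unsuccessfulCost P h j = 0 then (1 : ℝ) else 0) =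
      (m : ℝ) ^ n * (m - n) := by
  have h1 : ∀ h : Fin n → Fin m, ∑ j, (if unsuccessfulCost P h j = 0 then (1 : ℝ) else 0) =
      m - n := by
    intro h
    have H := stageInvariant hnm P h le_rfl
    have hval := H.valid
    have h3 := (stage P h n).card_emptyCells_add_card_occupied
    rw [H.card_occupied] at h3
    rw [stage_last] at hval h3
    have h2 : ∀ j, unsuccessfulCost P h j = 0 ↔ (Table.build P h).item j = none := by
      intro j
      change (Table.build P h).cost j = 0 ↔ _
      by_cases hj : (Table.build P h).item j = none
      · simp [hj, hval.cost_of_empty hj]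
      · rw [hval.cost_of_occ hj]
        simpa [hj] using Table.WellLinked.ne_nil hval j
    simp only [h2]
    rw [Finset.sum_boole, eq_sub_iff_add_eq]
    exact_mod_cast h3
  rw [Finset.sum_congr rfl fun h _ => h1 h]
  simp [mul_sub]

open Filter Topology

/-! ### Variances as finite sums -/

theorem variance_hashLaw_prod {m n N : ℕ} (hm : 0 < m) (hN : 0 < N)
    (X : (Fin n → Fin m) → Fin N → ℝ) :
    Var[fun ω : (Fin n → Fin m) × Fin N => X ω.1 ω.2; (hashLaw m n).prod (uniformOn Set.univ)] =
      (∑ h, ∑ j, X h j ^ 2) / ((m : ℝ) ^ n * N) -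
        ((∑ h, ∑ j, X h j) / ((m : ℝ) ^ n * N)) ^ 2 := by
  have : NeZero m := ⟨hm.ne'⟩
  have : NeZero N := ⟨hN.ne'⟩
  have h1 : IsProbabilityMeasure (uniformOn (Set.univ : Set (Fin m))) :=
    isProbabilityMeasure_uniformOn Set.finite_univ Set.univ_nonempty
  have h2 : IsProbabilityMeasure (uniformOn (Set.univ : Set (Fin N))) :=
    isProbabilityMeasure_uniformOn Set.finite_univ Set.univ_nonempty
  have h3 : IsProbabilityMeasure (hashLaw m n) := by unfold hashLaw; infer_instance
  have hsingle : ∀ (M : ℕ) (c : Fin M), uniformOn (Set.univ : Set (Fin M)) {c} = (M : ENNReal)⁻¹ := by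
    intro M c
    rw [uniformOn_univ, Measure.count_singleton, Fintype.card_fin, one_div]
  have hint : ∀ Y : (Fin n → Fin m) → Fin N → ℝ,
      ∫ ω : (Fin n → Fin m) × Fin N, Y ω.1 ω.2 ∂((hashLaw m n).prod (uniformOn Set.univ)) =
        (∑ h, ∑ j, Y h j) / ((m : ℝ) ^ n * N) := by
    intro Y
    rw [integral_fintype .of_finite, Fintype.sum_prod_type, Finset.sum_div]
    refine Finset.sum_congr rfl fun h _ => ?_
    rw [Finset.sum_div]
    refine Finset.sum_congr rfl fun j _ => ?_
    have h4 : ((hashLaw m n).prod (uniformOn Set.univ)).real {(h, j)} =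
        ((m : ℝ) ^ n * N)⁻¹ := by
      rw [measureReal_def, ← Set.singleton_prod_singleton, Measure.prod_prod, hashLaw,
        Measure.pi_singleton, hsingle, Finset.prod_congr rfl fun i _ => hsingle m (h i)]
      simp [mul_comm]
    rw [h4, smul_eq_mul, div_eq_inv_mul]
  rw [variance_eq_sub MemLp.of_discrete]
  simp only [Pi.pow_apply]
  rw [hint X, hint fun h j => X h j ^ 2]

/-! ### The limits of the powers -/

/-- The quotient is `c` times the slope of `exp` between 0 and `c * x`. The extended slope `dslope`
is continuous also at 0, which treats `α = 0` together with the other values. -/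
theorem tendsto_expQuot {x c : ℕ → ℝ} {α κ : ℝ} (hx : Tendsto x atTop (𝓝 α))
    (hc : Tendsto c atTop (𝓝 κ)) (hx0 : ∀ᶠ i in atTop, x i ≠ 0) (hc0 : ∀ᶠ i in atTop, c i ≠ 0)
    (hκ : κ ≠ 0) :
    Tendsto (fun i => (Real.exp (c i * x i) - 1) / x i) atTop (𝓝 (expQuot κ α)) := by
  have hφ : Continuous (dslope Real.exp 0) := by
    rw [continuous_iff_continuousAt]
    intro y
    by_cases hy : y = 0
    · subst hy; exact continuousAt_dslope_same.2 Real.differentiableAt_exp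
    · exact (continuousAt_dslope_of_ne hy).2 Real.continuous_exp.continuousAt
  have hlim : κ * dslope Real.exp 0 (κ * α) = expQuot κ α := by
    unfold expQuot
    split_ifs with h
    · simp [h]
    · rw [dslope_of_ne _ (mul_ne_zero hκ h), slope_def_field]
      field_simp
      simp
  rw [← hlim]
  refine (hc.mul ((hφ.tendsto _).comp (hc.mul hx))).congr' ?_
  filter_upwards [hx0, hc0] with i h1 h2
  rw [Function.comp_apply, dslope_of_ne _ (mul_ne_zero h2 h1), slope_def_field]
  field_simp
  simp

section limits

variable {m n : ℕ → ℕ} {α : ℝ} (hm : Tendsto m atTop atTop) (hpos : ∀ i, 0 < n i)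
  (hle : ∀ i, n i ≤ m i) (hlim : Tendsto (fun i => (n i : ℝ) / (m i : ℝ)) atTop (𝓝 α))

include hm

theorem tendsto_mul_log {κ : ℝ} :
    Tendsto (fun i => (m i : ℝ) * Real.log (1 + κ / m i)) atTop (𝓝 κ) :=
  (Real.tendsto_mul_log_one_add_div_atTop κ).comp (tendsto_natCast_atTop_atTop.comp hm)

include hpos hle

omit hm in
-- The exponent is split into a factor tending to `κ` and the load `n / m`, so that the quotient by
-- `n / m` has the form required by `tendsto_expQuot`.
theorem one_add_div_pow_eq {κ : ℝ} (hκ : 0 < κ) (i : ℕ) :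
    (1 + κ / m i) ^ n i =
      Real.exp ((m i * Real.log (1 + κ / m i)) * ((n i : ℝ) / m i)) := by
  have h1 : (0 : ℝ) < m i := by exact_mod_cast (hpos i).trans_le (hle i)
  have h2 : 0 < 1 + κ / m i := by positivity
  rw [← Real.exp_log h2, ← Real.exp_nat_mul, Real.exp_log h2]
  congr 1
  field_simp

include hlim

theorem tendsto_one_add_div_pow {κ : ℝ} (hκ : 0 < κ) :
    Tendsto (fun i => (1 + κ / m i) ^ n i) atTop (𝓝 (Real.exp (κ * α))) := by
  simp only [one_add_div_pow_eq hpos hle hκ]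
  exact (Real.continuous_exp.tendsto _).comp ((tendsto_mul_log hm).mul hlim)

theorem tendsto_one_add_div_pow_quot {κ : ℝ} (hκ : 0 < κ) :
    Tendsto (fun i => ((1 + κ / m i) ^ n i - 1) / ((n i : ℝ) / m i)) atTop
      (𝓝 (expQuot κ α)) := by
  simp only [one_add_div_pow_eq hpos hle hκ]
  have h0 : ∀ i, (0 : ℝ) < m i := fun i => by exact_mod_cast (hpos i).trans_le (hle i)
  refine tendsto_expQuot hlim (tendsto_mul_log hm) (Eventually.of_forall fun i => ?_)
    (Eventually.of_forall fun i => ?_) hκ.ne'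
  · have := h0 i
    have : (0 : ℝ) < n i := by exact_mod_cast hpos i
    positivity
  · have h1 := h0 i
    have : 0 < Real.log (1 + κ / m i) := Real.log_pos (by
      have : 0 < κ / m i := by positivity
      linarith)
    positivity

/-! ### The limits of the variances -/

theorem tendsto_varUnsuccessfulCost (P : Policy) :
    Tendsto (fun i => varUnsuccessfulCost P (m i) (n i)) atTop
      (𝓝 ((2 / 9 * (2 * (Real.exp (3 * α) - 1) + 3 * α) -
        1 / 4 * (Real.exp (2 * α) - 1 + 2 * α)) -
        (1 / 4 * (Real.exp (2 * α) - 1 + 2 * α)) ^ 2)) := by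
  have h2 := tendsto_one_add_div_pow hm hpos hle hlim (κ := 2) (by norm_num)
  have h3 := tendsto_one_add_div_pow hm hpos hle hlim (κ := 3) (by norm_num)
  have key : Tendsto (fun i => (2 / 9 * (2 * ((1 + 3 / m i) ^ n i - 1) + 3 * ((n i : ℝ) / m i)) -
        1 / 4 * ((1 + 2 / m i) ^ n i - 1 + 2 * ((n i : ℝ) / m i))) -
        (1 / 4 * ((1 + 2 / m i) ^ n i - 1 + 2 * ((n i : ℝ) / m i))) ^ 2) atTop
      (𝓝 ((2 / 9 * (2 * (Real.exp (3 * α) - 1) + 3 * α) -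
        1 / 4 * (Real.exp (2 * α) - 1 + 2 * α)) -
        (1 / 4 * (Real.exp (2 * α) - 1 + 2 * α)) ^ 2)) :=
    ((((((h3.sub_const 1).const_mul 2).add (hlim.const_mul 3)).const_mul _).sub
      ((((h2.sub_const 1)).add (hlim.const_mul 2)).const_mul _)).sub
      (((((h2.sub_const 1)).add (hlim.const_mul 2)).const_mul _).pow 2))
  refine key.congr fun i => ?_
  have hm0 : 0 < m i := (hpos i).trans_le (hle i)
  have hm' : (m i : ℝ) ≠ 0 := by positivity
  have e1 := sum_unsuccessfulCost hm0 (hle i) P (f := fun d => (d : ℝ)) (by simp) (κ := 2)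
    (by norm_num) (by intro d; push_cast; ring)
  -- `d ^ 2` does not satisfy a closed recurrence; the second moment is recovered as `d * (d + 1) -
  -- d`.
  have e2 := sum_unsuccessfulCost hm0 (hle i) P (f := fun d => (d : ℝ) * (d + 1)) (by simp)
    (κ := 3) (by norm_num) (by intro d; push_cast; ring)
  rw [varUnsuccessfulCost, variance_hashLaw_prod hm0 hm0
    (fun h j => (unsuccessfulCost P h j : ℝ)), e1]
  have e3 : ∑ h : Fin (n i) → Fin (m i), ∑ j, (unsuccessfulCost P h j : ℝ) ^ 2 =
      (∑ h : Fin (n i) → Fin (m i), ∑ j,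
        (unsuccessfulCost P h j : ℝ) * (unsuccessfulCost P h j + 1)) -
        ∑ h : Fin (n i) → Fin (m i), ∑ j, (unsuccessfulCost P h j : ℝ) := by
    simp only [← Finset.sum_sub_distrib]
    refine Finset.sum_congr rfl fun h _ => Finset.sum_congr rfl fun j _ => by ring
  rw [e3, e2, e1]
  have hp : (m i : ℝ) ^ n i ≠ 0 := pow_ne_zero _ hm'
  push_cast
  rw [← mul_sub, mul_div_cancel_left₀ _ (mul_ne_zero hp hm'),
    mul_div_cancel_left₀ _ (mul_ne_zero hp hm')]
  ring

theorem tendsto_varUnsuccessfulProbes (P : Policy) :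
    Tendsto (fun i => varUnsuccessfulProbes P (m i) (n i)) atTop
      (𝓝 ((2 / 9 * (2 * (Real.exp (3 * α) - 1) + 3 * α) -
        1 / 4 * (Real.exp (2 * α) - 1 + 2 * α) + (1 - α)) -
        (1 / 4 * (Real.exp (2 * α) - 1 + 2 * α) + (1 - α)) ^ 2)) := by
  have h2 := tendsto_one_add_div_pow hm hpos hle hlim (κ := 2) (by norm_num)
  have h3 := tendsto_one_add_div_pow hm hpos hle hlim (κ := 3) (by norm_num)
  have key : Tendsto (fun i => (2 / 9 * (2 * ((1 + 3 / m i) ^ n i - 1) + 3 * ((n i : ℝ) / m i)) -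
        1 / 4 * ((1 + 2 / m i) ^ n i - 1 + 2 * ((n i : ℝ) / m i)) + (1 - (n i : ℝ) / m i)) -
        (1 / 4 * ((1 + 2 / m i) ^ n i - 1 + 2 * ((n i : ℝ) / m i)) +
          (1 - (n i : ℝ) / m i)) ^ 2) atTop
      (𝓝 ((2 / 9 * (2 * (Real.exp (3 * α) - 1) + 3 * α) -
        1 / 4 * (Real.exp (2 * α) - 1 + 2 * α) + (1 - α)) -
        (1 / 4 * (Real.exp (2 * α) - 1 + 2 * α) + (1 - α)) ^ 2)) :=
    (((((((h3.sub_const 1).const_mul 2).add (hlim.const_mul 3)).const_mul _).sub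
      ((((h2.sub_const 1)).add (hlim.const_mul 2)).const_mul _)).add (hlim.const_sub 1)).sub
      ((((((h2.sub_const 1)).add (hlim.const_mul 2)).const_mul _).add (hlim.const_sub 1)).pow 2))
  refine key.congr fun i => ?_
  have hm0 : 0 < m i := (hpos i).trans_le (hle i)
  have hm' : (m i : ℝ) ≠ 0 := by positivity
  have e1 := sum_unsuccessfulCost hm0 (hle i) P (f := fun d => (d : ℝ)) (by simp) (κ := 2)
    (by norm_num) (by intro d; push_cast; ring)
  have e2 := sum_unsuccessfulCost hm0 (hle i) P (f := fun d => (d : ℝ) * (d + 1)) (by simp)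
    (κ := 3) (by norm_num) (by intro d; push_cast; ring)
  have e0 := sum_unsuccessfulCost_eq_zero (hle i) P
  -- The indicator is orthogonal to `d`, so the first and the second moment both increase by the
  -- proportion of empty cells.
  have hmax : ∀ d : ℕ, ((max d 1 : ℕ) : ℝ) = d + if d = 0 then 1 else 0 := by
    intro d; rcases d with _ | d <;> simp
  rw [varUnsuccessfulProbes, variance_hashLaw_prod hm0 hm0
    (fun h j => (unsuccessfulProbes P h j : ℝ))]
  have e4 : ∑ h : Fin (n i) → Fin (m i), ∑ j, (unsuccessfulProbes P h j : ℝ) =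
      (∑ h : Fin (n i) → Fin (m i), ∑ j, (unsuccessfulCost P h j : ℝ)) +
        ∑ h : Fin (n i) → Fin (m i), ∑ j, (if unsuccessfulCost P h j = 0 then (1 : ℝ) else 0) := by
    simp only [← Finset.sum_add_distrib]
    refine Finset.sum_congr rfl fun h _ => Finset.sum_congr rfl fun j _ => ?_
    rw [unsuccessfulProbes, hmax]
  have e3 : ∑ h : Fin (n i) → Fin (m i), ∑ j, (unsuccessfulProbes P h j : ℝ) ^ 2 =
      (∑ h : Fin (n i) → Fin (m i), ∑ j,
        (unsuccessfulCost P h j : ℝ) * (unsuccessfulCost P h j + 1)) -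
        (∑ h : Fin (n i) → Fin (m i), ∑ j, (unsuccessfulCost P h j : ℝ)) +
        ∑ h : Fin (n i) → Fin (m i), ∑ j, (if unsuccessfulCost P h j = 0 then (1 : ℝ) else 0) := by
    simp only [← Finset.sum_sub_distrib, ← Finset.sum_add_distrib]
    refine Finset.sum_congr rfl fun h _ => Finset.sum_congr rfl fun j _ => ?_
    rw [unsuccessfulProbes, hmax]
    split_ifs with h0
    · simp [h0]
    · ring
  rw [e3, e4, e2, e1, e0]
  have hp : (m i : ℝ) ^ n i ≠ 0 := pow_ne_zero _ hm'
  have e5 : (m i : ℝ) ^ n i * (m i - n i) = (m i : ℝ) ^ n i * m i * (1 - (n i : ℝ) / m i) := by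
    field_simp
  push_cast
  rw [e5, ← mul_sub, ← mul_add, ← mul_add, mul_div_cancel_left₀ _ (mul_ne_zero hp hm'),
    mul_div_cancel_left₀ _ (mul_ne_zero hp hm')]
  ring

theorem tendsto_varDisplacement_late (hn : Tendsto n atTop atTop) :
    Tendsto (fun i => varDisplacement .late (m i) (n i)) atTop
      (𝓝 ((2 / 9 * (2 * (expQuot 3 α / 3 - 1) + 3 / 2 * α) -
        1 / 4 * (expQuot 2 α / 2 - 1 + α)) -
        (1 / 4 * (expQuot 2 α / 2 - 1 + α)) ^ 2)) := by
  have h2 := tendsto_one_add_div_pow_quot hm hpos hle hlim (κ := 2) (by norm_num)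
  have h3 := tendsto_one_add_div_pow_quot hm hpos hle hlim (κ := 3) (by norm_num)
  -- This is `(n - 1) / m`, from the sum of the linear terms over the `n` insertions.
  have h1 : Tendsto (fun i => (n i : ℝ) / m i * (1 - (n i : ℝ)⁻¹)) atTop (𝓝 α) := by
    have := hlim.mul ((tendsto_inv_atTop_zero.comp
      (tendsto_natCast_atTop_atTop.comp hn)).const_sub (1 : ℝ))
    simpa using this
  have key : Tendsto (fun i =>
      (2 / 9 * (2 * (((1 + 3 / m i) ^ n i - 1) / ((n i : ℝ) / m i) / 3 - 1)
        + 3 / 2 * ((n i : ℝ) / m i * (1 - (n i : ℝ)⁻¹))) -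
        1 / 4 * (((1 + 2 / m i) ^ n i - 1) / ((n i : ℝ) / m i) / 2 - 1
          + (n i : ℝ) / m i * (1 - (n i : ℝ)⁻¹))) -
        (1 / 4 * (((1 + 2 / m i) ^ n i - 1) / ((n i : ℝ) / m i) / 2 - 1
          + (n i : ℝ) / m i * (1 - (n i : ℝ)⁻¹))) ^ 2) atTop
      (𝓝 ((2 / 9 * (2 * (expQuot 3 α / 3 - 1) + 3 / 2 * α) -
        1 / 4 * (expQuot 2 α / 2 - 1 + α)) -
        (1 / 4 * (expQuot 2 α / 2 - 1 + α)) ^ 2)) :=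
    (((((((h3.div_const 3).sub_const 1).const_mul 2).add (h1.const_mul _)).const_mul _).sub
      (((((h2.div_const 2).sub_const 1)).add h1).const_mul _)).sub
      ((((((h2.div_const 2).sub_const 1)).add h1).const_mul _).pow 2))
  refine key.congr fun i => ?_
  have hm0 : 0 < m i := (hpos i).trans_le (hle i)
  have hm' : (m i : ℝ) ≠ 0 := by positivity
  have hn' : (n i : ℝ) ≠ 0 := by have := hpos i; positivity
  have e1 := sum_displacement_late hm0 (hle i) (f := fun d => (d : ℝ)) (by simp) (κ := 2)
    (by norm_num) (by intro d; push_cast; ring)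
  have e2 := sum_displacement_late hm0 (hle i) (f := fun d => (d : ℝ) * (d + 1)) (by simp)
    (κ := 3) (by norm_num) (by intro d; push_cast; ring)
  rw [varDisplacement, variance_hashLaw_prod hm0 (hpos i)
    (fun h j => (displacement .late h j : ℝ)), e1]
  have e3 : ∑ h : Fin (n i) → Fin (m i), ∑ j, (displacement .late h j : ℝ) ^ 2 =
      (∑ h : Fin (n i) → Fin (m i), ∑ j,
        (displacement .late h j : ℝ) * (displacement .late h j + 1)) -
        ∑ h : Fin (n i) → Fin (m i), ∑ j, (displacement .late h j : ℝ) := by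
    simp only [← Finset.sum_sub_distrib]
    refine Finset.sum_congr rfl fun h _ => Finset.sum_congr rfl fun j _ => by ring
  rw [e3, e2, e1]
  have hp : (m i : ℝ) ^ n i ≠ 0 := pow_ne_zero _ hm'
  push_cast
  rw [← mul_sub, mul_div_mul_left _ _ hp, mul_div_mul_left _ _ hp]
  field_simp
  ring

theorem tendsto_varDisplacement_early :
    Tendsto (fun i => varDisplacement .early (m i) (n i)) atTop
      (𝓝 (((expQuot 2 α / 2 - 1) - (expQuot 1 α - 1)) - (expQuot 1 α - 1) ^ 2)) := by
  have h1 := tendsto_one_add_div_pow_quot hm hpos hle hlim (κ := 1) (by norm_num)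
  have h2 := tendsto_one_add_div_pow_quot hm hpos hle hlim (κ := 2) (by norm_num)
  refine (((((h2.div_const 2).sub_const 1).sub (h1.sub_const 1))).sub
    ((h1.sub_const 1).pow 2)).congr fun i => ?_
  have hm0 : 0 < m i := (hpos i).trans_le (hle i)
  have hm' : (m i : ℝ) ≠ 0 := by positivity
  have hn' : (n i : ℝ) ≠ 0 := by have := hpos i; positivity
  have e1 := sum_displacement_early hm0 (hle i) (f := fun d => (d : ℝ)) (by simp) (κ := 1)
    (by norm_num) (by intro d; push_cast; ring)
  have e2 := sum_displacement_early hm0 (hle i) (f := fun d => (d : ℝ) * (d + 1)) (by simp)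
    (κ := 2) (by norm_num) (by intro d; push_cast; ring)
  rw [varDisplacement, variance_hashLaw_prod hm0 (hpos i)
    (fun h j => (displacement .early h j : ℝ)), e1]
  have e3 : ∑ h : Fin (n i) → Fin (m i), ∑ j, (displacement .early h j : ℝ) ^ 2 =
      (∑ h : Fin (n i) → Fin (m i), ∑ j,
        (displacement .early h j : ℝ) * (displacement .early h j + 1)) -
        ∑ h : Fin (n i) → Fin (m i), ∑ j, (displacement .early h j : ℝ) := by
    simp only [← Finset.sum_sub_distrib]
    refine Finset.sum_congr rfl fun h _ => Finset.sum_congr rfl fun j _ => by ring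
  rw [e3, e2, e1]
  have hp : (m i : ℝ) ^ n i ≠ 0 := pow_ne_zero _ hm'
  push_cast
  rw [← mul_sub, mul_div_mul_left _ _ hp, mul_div_mul_left _ _ hp]
  field_simp
  ring

end limits

/-! ### Distributions on the natural numbers -/

theorem law_eq_sum_dirac (p : ℕ → ℝ) :
    law p = Measure.sum fun k => ENNReal.ofReal (p k) • Measure.dirac (id k) := rfl

theorem IsDistribution.isProbabilityMeasure {p : ℕ → ℝ} (hp : IsDistribution p) :
    IsProbabilityMeasure (law p) := by
  refine ⟨?_⟩
  rw [law, Measure.sum_apply _ MeasurableSet.univ]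
  simp only [Measure.smul_apply, measure_univ, smul_eq_mul, mul_one]
  rw [← ENNReal.ofReal_tsum_of_nonneg hp.1 hp.2.1.summable, hp.2.1.tsum_eq, ENNReal.ofReal_one]

theorem integral_law {p : ℕ → ℝ} (hp : ∀ k, 0 ≤ p k) (f : ℕ → ℝ) {a : ℝ}
    (h : HasSum (fun k => f k * p k) a) : ∫ k, f k ∂(law p) = a := by
  rw [law_eq_sum_dirac, integral_sum_dirac (by simp), ← h.tsum_eq]
  congr 1
  ext k
  rw [ENNReal.toReal_ofReal (hp k), smul_eq_mul, mul_comm, id]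

theorem variance_law {p : ℕ → ℝ} (hp : IsDistribution p) (f : ℕ → ℝ) {a b : ℝ}
    (h1 : HasSum (fun k => f k * p k) a) (h2 : HasSum (fun k => f k ^ 2 * p k) b) :
    variance f (law p) = b - a ^ 2 := by
  have := hp.isProbabilityMeasure
  have hL : MemLp f 2 (law p) := by
    rw [memLp_two_iff_integrable_sq (measurable_from_top.aestronglyMeasurable), law_eq_sum_dirac]
    refine integrable_sum_dirac (by simp) (h2.summable.congr fun k => ?_)
    rw [ENNReal.toReal_ofReal (hp.1 k), id, norm_pow, Real.norm_eq_abs, sq_abs, mul_comm]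
  rw [variance_eq_sub hL, integral_law hp.1 f h1]
  congr 1
  exact integral_law hp.1 (f ^ 2) h2

/-! ### Power series integrated against a weight -/

theorem one_sub_exp_neg_mem {t : ℝ} (ht : t ∈ Set.Icc (0 : ℝ) 1) :
    0 ≤ 1 - Real.exp (-t) ∧ 1 - Real.exp (-t) ≤ 1 - Real.exp (-1) := by
  have h1 : Real.exp (-t) ≤ 1 := Real.exp_le_one_iff.2 (by linarith [ht.1])
  have h2 : Real.exp (-1) ≤ Real.exp (-t) := Real.exp_le_exp.2 (by linarith [ht.2])
  constructor <;> linarith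

theorem one_sub_exp_neg_one_lt : 1 - Real.exp (-1) < 1 := by
  linarith [Real.exp_pos (-1)]

theorem one_sub_exp_neg_one_nonneg : 0 ≤ 1 - Real.exp (-1) :=
  (one_sub_exp_neg_mem (t := 1) (by simp)).1

/-- Termwise integration of a power series in `1 - exp (-t)` against a continuous weight. -/
theorem hasSum_integral_weight {α : ℝ} (hα : α ∈ Set.Icc (0 : ℝ) 1) {w : ℝ → ℝ}
    (hw : Continuous w) {a : ℕ → ℝ} (ha : ∀ k, 0 ≤ a k)
    {g : ℝ → ℝ} (hg : ∀ x : ℝ, 0 ≤ x → x < 1 → HasSum (fun k => a k * x ^ k) (g x)) :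
    HasSum (fun k => a k * ∫ t in (0 : ℝ)..α, w t * (1 - Real.exp (-t)) ^ k)
      (∫ t in (0 : ℝ)..α, w t * g (1 - Real.exp (-t))) := by
  obtain ⟨C, hC⟩ := (isCompact_Icc (a := (0 : ℝ)) (b := 1)).exists_bound_of_continuousOn
    hw.continuousOn
  have hmem : ∀ t ∈ Set.uIoc 0 α, t ∈ Set.Icc (0 : ℝ) 1 := by
    intro t ht
    rw [Set.uIoc_of_le hα.1] at ht
    exact ⟨ht.1.le, ht.2.trans hα.2⟩
  have hC0 : 0 ≤ C := (norm_nonneg _).trans (hC 0 (by simp))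
  have key := intervalIntegral.hasSum_integral_of_dominated_convergence (a := 0) (b := α)
    (μ := volume) (F := fun k t => a k * (w t * (1 - Real.exp (-t)) ^ k))
    (f := fun t => w t * g (1 - Real.exp (-t)))
    -- On `[0, 1]` the base `1 - exp (-t)` is at most `1 - exp (-1) < 1`, so the value of the power
    -- series there gives a summable dominating constant.
    (fun k _ => C * (a k * (1 - Real.exp (-1)) ^ k))
    (fun k => by
      have : Continuous fun t => a k * (w t * (1 - Real.exp (-t)) ^ k) := by fun_prop
      exact this.aestronglyMeasurable)
    (fun k => Eventually.of_forall fun t ht => by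
      have h1 := one_sub_exp_neg_mem (hmem t ht)
      have h2 := hC t (hmem t ht)
      rw [norm_mul, norm_mul, norm_pow, Real.norm_of_nonneg (ha k), Real.norm_of_nonneg h1.1]
      have h3 : (1 - Real.exp (-t)) ^ k ≤ (1 - Real.exp (-1)) ^ k :=
        pow_le_pow_left₀ h1.1 h1.2 k
      have h4 : ‖w t‖ * (1 - Real.exp (-t)) ^ k ≤ C * (1 - Real.exp (-1)) ^ k :=
        mul_le_mul h2 h3 (pow_nonneg h1.1 k) hC0
      calc a k * (‖w t‖ * (1 - Real.exp (-t)) ^ k) ≤ a k * (C * (1 - Real.exp (-1)) ^ k) :=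
            mul_le_mul_of_nonneg_left h4 (ha k)
        _ = _ := by ring)
    (Eventually.of_forall fun t _ =>
      (hg _ one_sub_exp_neg_one_nonneg one_sub_exp_neg_one_lt).summable.mul_left C)
    intervalIntegrable_const
    (Eventually.of_forall fun t ht => by
      have h1 := one_sub_exp_neg_mem (hmem t ht)
      have := (hg _ h1.1 (h1.2.trans_lt one_sub_exp_neg_one_lt)).mul_left (w t)
      refine this.congr_fun ?_
      intro k; ring)
  simpa only [intervalIntegral.integral_const_mul] using key

theorem hasSum_succ_mul_geometric {x : ℝ} (h0 : 0 ≤ x) (h1 : x < 1) :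
    HasSum (fun k : ℕ => ((k : ℝ) + 1) * x ^ k) (((1 - x)⁻¹) ^ 2) := by
  have := hasSum_choose_mul_geometric_of_norm_lt_one 1 (r := x) (by rwa [Real.norm_of_nonneg h0])
  simpa using this

/-- Expand `(k + 1) ^ 2 = 2 * (k + 2).choose 2 - (k + 1)` and use the negative binomial series. -/
theorem hasSum_succ_sq_mul_geometric {x : ℝ} (h0 : 0 ≤ x) (h1 : x < 1) :
    HasSum (fun k : ℕ => ((k : ℝ) + 1) ^ 2 * x ^ k) (2 * ((1 - x)⁻¹) ^ 3 - ((1 - x)⁻¹) ^ 2) := by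
  have := hasSum_choose_mul_geometric_of_norm_lt_one 2 (r := x) (by rwa [Real.norm_of_nonneg h0])
  have h2 := (this.mul_left 2).sub (hasSum_succ_mul_geometric h0 h1)
  rw [one_div, ← inv_pow] at h2
  refine h2.congr_fun fun k => ?_
  rw [Nat.cast_choose_two]
  push_cast
  ring

theorem hasSum_of_succ {u : ℕ → ℝ} {a : ℝ} (h : HasSum (fun k => u (k + 1)) a) :
    HasSum u (u 0 + a) := by
  have := (hasSum_nat_add_iff 1).1 h
  simpa [add_comm] using this

/-- The first moments of a mixture of geometric distributions. -/
theorem isDistribution_of_weight {α : ℝ} (hα : α ∈ Set.Icc (0 : ℝ) 1) {w : ℝ → ℝ}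
    (hw : Continuous w) (hw0 : ∀ t ∈ Set.Icc 0 α, 0 ≤ w t) {c : ℝ} (hc : 0 ≤ c) {p : ℕ → ℝ}
    (hp0 : 0 ≤ p 0) (hp : ∀ k, p (k + 1) = c * ∫ t in (0 : ℝ)..α, w t * (1 - Real.exp (-t)) ^ k)
    (htot : p 0 + c * (∫ t in (0 : ℝ)..α, w t * Real.exp t) = 1) :
    IsDistribution p ∧
      HasSum (fun k : ℕ => (k : ℝ) * p k) (c * ∫ t in (0 : ℝ)..α, w t * Real.exp t ^ 2) ∧
      HasSum (fun k : ℕ => (k : ℝ) ^ 2 * p k)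
        (c * ∫ t in (0 : ℝ)..α, w t * (2 * Real.exp t ^ 3 - Real.exp t ^ 2)) := by
  -- Each factor `1 / (1 - x)` in a generating function becomes a factor `exp t`.
  have hexp : ∀ t : ℝ, (1 - (1 - Real.exp (-t)))⁻¹ = Real.exp t := by
    intro t; rw [sub_sub_cancel, Real.exp_neg, inv_inv]
  have s0 := hasSum_integral_weight hα hw (a := fun _ => 1) (by simp) (g := fun x => (1 - x)⁻¹)
    (fun x h0 h1 => by simpa using hasSum_geometric_of_lt_one h0 h1)
  have s1 := hasSum_integral_weight hα hw (a := fun k => (k : ℝ) + 1) (fun k => by positivity)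
    (fun x h0 h1 => hasSum_succ_mul_geometric h0 h1)
  have s2 := hasSum_integral_weight hα hw (a := fun k => ((k : ℝ) + 1) ^ 2)
    (fun k => by positivity) (fun x h0 h1 => hasSum_succ_sq_mul_geometric h0 h1)
  simp only [hexp, one_mul] at s0 s1 s2
  have t0 : HasSum p 1 := by
    rw [← htot]
    refine hasSum_of_succ ((s0.mul_left c).congr_fun fun k => ?_)
    rw [hp]
  have t1 : HasSum (fun k : ℕ => (k : ℝ) * p k)
      (c * ∫ t in (0 : ℝ)..α, w t * Real.exp t ^ 2) := by
    have : HasSum (fun k : ℕ => ((k + 1 : ℕ) : ℝ) * p (k + 1))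
        (c * ∫ t in (0 : ℝ)..α, w t * Real.exp t ^ 2) := by
      refine (s1.mul_left c).congr_fun fun k => ?_
      rw [hp]; push_cast; ring
    simpa using hasSum_of_succ (u := fun k : ℕ => (k : ℝ) * p k) this
  have t2 : HasSum (fun k : ℕ => (k : ℝ) ^ 2 * p k)
      (c * ∫ t in (0 : ℝ)..α, w t * (2 * Real.exp t ^ 3 - Real.exp t ^ 2)) := by
    have : HasSum (fun k : ℕ => ((k + 1 : ℕ) : ℝ) ^ 2 * p (k + 1))
        (c * ∫ t in (0 : ℝ)..α, w t * (2 * Real.exp t ^ 3 - Real.exp t ^ 2)) := by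
      refine (s2.mul_left c).congr_fun fun k => ?_
      rw [hp]; push_cast; ring
    simpa using hasSum_of_succ (u := fun k : ℕ => (k : ℝ) ^ 2 * p k) this
  refine ⟨⟨fun k => ?_, t0, t2.summable⟩, t1, t2⟩
  cases k with
  | zero => exact hp0
  | succ k =>
    rw [hp]
    refine mul_nonneg hc (intervalIntegral.integral_nonneg hα.1 fun t ht => ?_)
    exact mul_nonneg (hw0 t ht)
      (pow_nonneg (one_sub_exp_neg_mem ⟨ht.1, ht.2.trans hα.2⟩).1 k)

/-- The antiderivative is `exp (κ * t) * (A + B * t + C * t ^ 2)`; comparing coefficients gives `C =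
c / κ`, `B = (b - 2 * C) / κ`, `A = (a - B) / κ`. -/
theorem integral_quadratic_mul_exp (a b c α : ℝ) {κ : ℝ} (hκ : κ ≠ 0) :
    ∫ t in (0 : ℝ)..α, (a + b * t + c * t ^ 2) * Real.exp (κ * t) =
      Real.exp (κ * α) * (((a - (b - 2 * (c / κ)) / κ) / κ) + (b - 2 * (c / κ)) / κ * α
        + c / κ * α ^ 2) - (a - (b - 2 * (c / κ)) / κ) / κ := by
  have h : ∀ t : ℝ, HasDerivAt (fun t => Real.exp (κ * t) *
      (((a - (b - 2 * (c / κ)) / κ) / κ) + (b - 2 * (c / κ)) / κ * t + c / κ * t ^ 2))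
      ((a + b * t + c * t ^ 2) * Real.exp (κ * t)) t := by
    intro t
    have h1 : HasDerivAt (fun t => Real.exp (κ * t)) (Real.exp (κ * t) * κ) t := by
      simpa using ((hasDerivAt_id t).const_mul κ).exp
    have h2 : HasDerivAt (fun t => ((a - (b - 2 * (c / κ)) / κ) / κ) + (b - 2 * (c / κ)) / κ * t
        + c / κ * t ^ 2) ((b - 2 * (c / κ)) / κ + c / κ * (2 * t)) t := by
      have h3 := ((hasDerivAt_id t).const_mul ((b - 2 * (c / κ)) / κ)).const_add
        ((a - (b - 2 * (c / κ)) / κ) / κ)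
      have h4 := h3.fun_add ((hasDerivAt_pow 2 t).const_mul (c / κ))
      simpa using h4
    refine (h1.fun_mul h2).congr_deriv ?_
    field_simp
    ring
  rw [intervalIntegral.integral_eq_sub_of_hasDerivAt (fun t _ => h t)
    (by apply Continuous.intervalIntegrable; fun_prop)]
  simp

theorem exp_nat_mul_eq (α : ℝ) : Real.exp (2 * α) = Real.exp α ^ 2 ∧
    Real.exp (3 * α) = Real.exp α ^ 3 ∧ Real.exp (4 * α) = Real.exp α ^ 4 := by
  refine ⟨?_, ?_, ?_⟩ <;> rw [← Real.exp_nat_mul] <;> norm_num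

/-! ### Moments of the three limit laws -/

section laws

variable {α : ℝ} (hα : α ∈ Set.Icc (0 : ℝ) 1)

include hα

theorem pU_moments : IsDistribution (pU α) ∧
    HasSum (fun k : ℕ => (k : ℝ) * pU α k) (1 / 4 * (Real.exp (2 * α) - 1 + 2 * α)) ∧
    HasSum (fun k : ℕ => (k : ℝ) ^ 2 * pU α k)
      (2 / 9 * (2 * (Real.exp (3 * α) - 1) + 3 * α) -
        1 / 4 * (Real.exp (2 * α) - 1 + 2 * α)) := by
  have i1 := integral_quadratic_mul_exp (1 - α) 1 0 α (κ := 1) (by norm_num)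
  have i2 := integral_quadratic_mul_exp (1 - α) 1 0 α (κ := 2) (by norm_num)
  have i3 := integral_quadratic_mul_exp (1 - α) 1 0 α (κ := 3) (by norm_num)
  have j1 : ∫ t in (0 : ℝ)..α, (1 - α + t) * Real.exp t = α := by
    simp only [one_mul, zero_mul, add_zero] at i1
    rw [i1]; ring
  have j2 : ∫ t in (0 : ℝ)..α, (1 - α + t) * Real.exp t ^ 2 =
      1 / 4 * (Real.exp (2 * α) - 1 + 2 * α) := by
    simp only [one_mul, zero_mul, add_zero, fun t => (exp_nat_mul_eq t).1] at i2 ⊢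
    rw [i2]; ring
  have j3 : ∫ t in (0 : ℝ)..α, (1 - α + t) * (2 * Real.exp t ^ 3 - Real.exp t ^ 2) =
      2 / 9 * (2 * (Real.exp (3 * α) - 1) + 3 * α) -
        1 / 4 * (Real.exp (2 * α) - 1 + 2 * α) := by
    have : ∀ t : ℝ, (1 - α + t) * (2 * Real.exp t ^ 3 - Real.exp t ^ 2) =
        2 * ((1 - α + t) * Real.exp t ^ 3) - (1 - α + t) * Real.exp t ^ 2 := by intro t; ring
    simp only [this]
    rw [intervalIntegral.integral_sub (by apply Continuous.intervalIntegrable; fun_prop)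
      (by apply Continuous.intervalIntegrable; fun_prop), intervalIntegral.integral_const_mul, j2]
    simp only [one_mul, zero_mul, add_zero, fun t => (exp_nat_mul_eq t).2.1] at i3 ⊢
    rw [i3]; ring
  have := isDistribution_of_weight hα (w := fun t => 1 - α + t) (by fun_prop)
    (fun t ht => by linarith [ht.1, hα.2]) zero_le_one (p := pU α)
    (by simp only [pU]; linarith [hα.2]) (fun k => by simp only [pU, one_mul])
    (by rw [j1]; simp only [pU]; ring)
  rw [j2, j3] at this
  simpa only [one_mul] using this

theorem pL_moments : IsDistribution (pL α) ∧
    HasSum (fun k : ℕ => (k : ℝ) * pL α k) (1 / 4 * (expQuot 2 α / 2 - 1 + α)) ∧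
    HasSum (fun k : ℕ => (k : ℝ) ^ 2 * pL α k)
      (2 / 9 * (2 * (expQuot 3 α / 3 - 1) + 3 / 2 * α) -
        1 / 4 * (expQuot 2 α / 2 - 1 + α)) := by
  have i1 := integral_quadratic_mul_exp (α - α ^ 2 / 2) (α - 1) (-1 / 2) α (κ := 1) (by norm_num)
  have i2 := integral_quadratic_mul_exp (α - α ^ 2 / 2) (α - 1) (-1 / 2) α (κ := 2) (by norm_num)
  have i3 := integral_quadratic_mul_exp (α - α ^ 2 / 2) (α - 1) (-1 / 2) α (κ := 3) (by norm_num)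
  have hw : ∀ t : ℝ, α - α ^ 2 / 2 + (α - 1) * t + -1 / 2 * t ^ 2 =
      α - t - (α - t) ^ 2 / 2 := by intro t; ring
  simp only [hw, one_mul] at i1 i2 i3
  simp only [fun t => (exp_nat_mul_eq t).1] at i2
  simp only [fun t => (exp_nat_mul_eq t).2.1] at i3
  have j1 : α⁻¹ * ∫ t in (0 : ℝ)..α, (α - t - (α - t) ^ 2 / 2) * Real.exp t = α / 2 := by
    rw [i1]
    by_cases h : α = 0
    · simp [h]
    · field_simp; ring
  have j2 : α⁻¹ * ∫ t in (0 : ℝ)..α, (α - t - (α - t) ^ 2 / 2) * Real.exp t ^ 2 =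
      1 / 4 * (expQuot 2 α / 2 - 1 + α) := by
    rw [i2, expQuot]
    by_cases h : α = 0
    · simp [h]
    · rw [if_neg h, (exp_nat_mul_eq α).1]
      field_simp; ring
  have j3 : α⁻¹ * ∫ t in (0 : ℝ)..α, (α - t - (α - t) ^ 2 / 2) *
      (2 * Real.exp t ^ 3 - Real.exp t ^ 2) =
      2 / 9 * (2 * (expQuot 3 α / 3 - 1) + 3 / 2 * α) -
        1 / 4 * (expQuot 2 α / 2 - 1 + α) := by
    have : ∀ t : ℝ, (α - t - (α - t) ^ 2 / 2) * (2 * Real.exp t ^ 3 - Real.exp t ^ 2) =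
        2 * ((α - t - (α - t) ^ 2 / 2) * Real.exp t ^ 3) -
          (α - t - (α - t) ^ 2 / 2) * Real.exp t ^ 2 := by intro t; ring
    simp only [this]
    rw [intervalIntegral.integral_sub (by apply Continuous.intervalIntegrable; fun_prop)
      (by apply Continuous.intervalIntegrable; fun_prop), intervalIntegral.integral_const_mul,
      mul_sub, j2, i3]
    congr 1
    rw [expQuot]
    by_cases h : α = 0
    · simp [h]
    · rw [if_neg h, (exp_nat_mul_eq α).2.1]
      field_simp; ring
  have := isDistribution_of_weight hα (w := fun t => α - t - (α - t) ^ 2 / 2) (by fun_prop)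
    (fun t ht => by nlinarith [ht.1, ht.2, hα.2]) (inv_nonneg.2 hα.1) (p := pL α)
    (by simp only [pL]; linarith [hα.2])
    -- For `α = 0` the prefactor `α⁻¹` is 0 by convention, in agreement with the separate case in
    -- the definition.
    (fun k => by
      simp only [pL]
      split_ifs with h
      · simp [h]
      · rfl)
    (by rw [j1]; simp only [pL]; ring)
  rwa [j2, j3] at this

theorem pE_moments : IsDistribution (pE α) ∧
    HasSum (fun k : ℕ => (k : ℝ) * pE α k) (expQuot 1 α - 1) ∧
    HasSum (fun k : ℕ => (k : ℝ) ^ 2 * pE α k)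
      ((expQuot 2 α / 2 - 1) - (expQuot 1 α - 1)) := by
  have i1 := integral_quadratic_mul_exp α (-1) 0 α (κ := 1) (by norm_num)
  have i2 := integral_quadratic_mul_exp α (-1) 0 α (κ := 2) (by norm_num)
  have hw : ∀ t : ℝ, α + -1 * t + 0 * t ^ 2 = α - t := by intro t; ring
  simp only [hw, one_mul] at i1 i2
  simp only [fun t => (exp_nat_mul_eq t).1] at i2
  -- The factor `exp (-t)` in the weight lowers each power of `exp t` by one, so only `exp t` and
  -- its square remain against `α - t`.
  have hcancel : ∀ t : ℝ, Real.exp (-t) * Real.exp t = 1 := by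
    intro t; rw [← Real.exp_add]; simp
  have r1 : ∀ t : ℝ, (α - t) * Real.exp (-t) * Real.exp t = α - t := by
    intro t; rw [mul_assoc, hcancel, mul_one]
  have r2 : ∀ t : ℝ, (α - t) * Real.exp (-t) * Real.exp t ^ 2 = (α - t) * Real.exp t := by
    intro t; linear_combination (α - t) * Real.exp t * hcancel t
  have r3 : ∀ t : ℝ, (α - t) * Real.exp (-t) * (2 * Real.exp t ^ 3 - Real.exp t ^ 2) =
      2 * ((α - t) * Real.exp t ^ 2) - (α - t) * Real.exp t := by
    intro t
    linear_combination (α - t) * (2 * Real.exp t ^ 2 - Real.exp t) * hcancel t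
  have j1 : α⁻¹ * ∫ t in (0 : ℝ)..α, (α - t) * Real.exp (-t) * Real.exp t = α / 2 := by
    simp only [r1]
    rw [intervalIntegral.integral_sub (by simp) (by simp), integral_id,
      intervalIntegral.integral_const]
    by_cases h : α = 0
    · simp [h]
    · simp only [smul_eq_mul]; field_simp; ring
  have k1 : α⁻¹ * ∫ t in (0 : ℝ)..α, (α - t) * Real.exp t = expQuot 1 α - 1 := by
    rw [i1, expQuot]
    by_cases h : α = 0
    · simp [h]
    · rw [if_neg h, one_mul]
      field_simp; ring
  have j2 : α⁻¹ * ∫ t in (0 : ℝ)..α, (α - t) * Real.exp (-t) * Real.exp t ^ 2 =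
      expQuot 1 α - 1 := by
    simp only [r2]; exact k1
  have j3 : α⁻¹ * ∫ t in (0 : ℝ)..α, (α - t) * Real.exp (-t) *
      (2 * Real.exp t ^ 3 - Real.exp t ^ 2) =
      (expQuot 2 α / 2 - 1) - (expQuot 1 α - 1) := by
    simp only [r3]
    rw [intervalIntegral.integral_sub (by apply Continuous.intervalIntegrable; fun_prop)
      (by apply Continuous.intervalIntegrable; fun_prop), intervalIntegral.integral_const_mul,
      mul_sub, k1, i2]
    congr 1
    rw [expQuot]
    by_cases h : α = 0
    · simp [h]
    · rw [if_neg h, (exp_nat_mul_eq α).1]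
      field_simp; ring
  have := isDistribution_of_weight hα (w := fun t => (α - t) * Real.exp (-t)) (by fun_prop)
    (fun t ht => mul_nonneg (by linarith [ht.2]) (Real.exp_pos _).le) (inv_nonneg.2 hα.1)
    (p := pE α) (by simp only [pE]; linarith [hα.2])
    (fun k => by
      simp only [pE]
      split_ifs with h
      · simp [h]
      · rfl)
    (by rw [j1]; simp only [pE]; ring)
  rwa [j2, j3] at this

/-- For `r = 1, 2` one has `max k 1 ^ r = k ^ r` except at `k = 0`, where the value is 1 instead of
0; both moments gain the mass `1 - α` of 0. -/
theorem variance_max_law_pU :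
    variance (fun k : ℕ => ((max k 1 : ℕ) : ℝ)) (law (pU α)) =
      (2 / 9 * (2 * (Real.exp (3 * α) - 1) + 3 * α) -
        1 / 4 * (Real.exp (2 * α) - 1 + 2 * α) + (1 - α)) -
        (1 / 4 * (Real.exp (2 * α) - 1 + 2 * α) + (1 - α)) ^ 2 := by
  obtain ⟨h0, h1, h2⟩ := pU_moments hα
  have hs : HasSum (fun k : ℕ => if k = 0 then 1 - α else 0) (1 - α) := hasSum_ite_eq 0 (1 - α)
  refine variance_law h0 _ ((h1.add hs).congr_fun fun k => ?_) ((h2.add hs).congr_fun fun k => ?_)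
  · cases k <;> simp [pU]
  · cases k <;> simp [pU]

end laws

end CoalescedHashing

/-! ### The variances and their limits -/

open CoalescedHashing in
theorem corollary2 (m n : ℕ → ℕ) (α : ℝ) (hα : α ∈ Set.Icc (0 : ℝ) 1)
    (hm : Filter.Tendsto m Filter.atTop Filter.atTop)
    (hn : Filter.Tendsto n Filter.atTop Filter.atTop)
    (hpos : ∀ i, 0 < n i) (hle : ∀ i, n i ≤ m i)
    (hlim : Filter.Tendsto (fun i => (n i : ℝ) / (m i : ℝ)) Filter.atTop (nhds α)) :
    -- the limit distributions are probability distributions with finite variance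
    (IsDistribution (pU α) ∧ IsDistribution (pL α) ∧ IsDistribution (pE α)) ∧
    -- the number of occupied cells in an unsuccessful search (under either policy)
    ((∀ P : Policy, Filter.Tendsto (fun i => varUnsuccessfulCost P (m i) (n i)) Filter.atTop
        (nhds (ProbabilityTheory.variance (fun k : ℕ => (k : ℝ)) (law (pU α))))) ∧
      ProbabilityTheory.variance (fun k : ℕ => (k : ℝ)) (law (pU α)) =
        -(1 / 16) * Real.exp (4 * α) + 4 / 9 * Real.exp (3 * α)
          - (1 / 4 * α + 1 / 8) * Real.exp (2 * α)
          - 1 / 4 * α ^ 2 + 5 / 12 * α - 37 / 144) ∧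
    -- the displacement under late insertion
    (Filter.Tendsto (fun i => varDisplacement .late (m i) (n i)) Filter.atTop
        (nhds (ProbabilityTheory.variance (fun k : ℕ => (k : ℝ)) (law (pL α)))) ∧
      ProbabilityTheory.variance (fun k : ℕ => (k : ℝ)) (law (pL α)) =
        -(1 / 64) * expQuot 2 α ^ 2
          + (64 * Real.exp (2 * α) + 37 * Real.exp α + 37) / 432 * expQuot 1 α
          - 1 / 16 * Real.exp (2 * α) - 1 / 16 * α ^ 2 + 5 / 24 * α - 7 / 36) ∧
    -- the displacement under early insertion
    (Filter.Tendsto (fun i => varDisplacement .early (m i) (n i)) Filter.atTop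
        (nhds (ProbabilityTheory.variance (fun k : ℕ => (k : ℝ)) (law (pE α)))) ∧
      ProbabilityTheory.variance (fun k : ℕ => (k : ℝ)) (law (pE α)) =
        (α - 2) / 2 * expQuot 1 α ^ 2 + 2 * expQuot 1 α - 1) ∧
    -- the number of probes in an unsuccessful search (under either policy)
    ((∀ P : Policy, Filter.Tendsto (fun i => varUnsuccessfulProbes P (m i) (n i)) Filter.atTop
        (nhds (ProbabilityTheory.variance (fun k : ℕ => ((max k 1 : ℕ) : ℝ)) (law (pU α))))) ∧
      ProbabilityTheory.variance (fun k : ℕ => ((max k 1 : ℕ) : ℝ)) (law (pU α)) =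
        -(1 / 16) * Real.exp (4 * α) + 4 / 9 * Real.exp (3 * α)
          + (1 / 4 * α - 5 / 8) * Real.exp (2 * α)
          - 1 / 4 * α ^ 2 - 1 / 12 * α + 35 / 144) := by
  obtain ⟨hU, hU1, hU2⟩ := pU_moments hα
  obtain ⟨hL, hL1, hL2⟩ := pL_moments hα
  obtain ⟨hE, hE1, hE2⟩ := pE_moments hα
  have vU := variance_law hU _ hU1 hU2
  have vL := variance_law hL _ hL1 hL2
  have vE := variance_law hE _ hE1 hE2
  have vM := variance_max_law_pU hα
  -- With all exponentials written as powers of `exp α`, the closed forms are rational identities in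
  -- `α` and `exp α`.
  obtain ⟨e2, e3, e4⟩ := exp_nat_mul_eq α
  refine ⟨⟨hU, hL, hE⟩, ⟨fun P => ?_, ?_⟩, ⟨?_, ?_⟩, ⟨?_, ?_⟩, fun P => ?_, ?_⟩
  · rw [vU]; exact tendsto_varUnsuccessfulCost hm hpos hle hlim P
  · rw [vU, e2, e3, e4]; ring
  · rw [vL]; exact tendsto_varDisplacement_late hm hpos hle hlim hn
  · rw [vL]
    by_cases h : α = 0
    · subst h; norm_num [expQuot]
    · simp only [expQuot, if_neg h, e2, e3, one_mul]
      field_simp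
      ring
  · rw [vE]; exact tendsto_varDisplacement_early hm hpos hle hlim
  · rw [vE]
    by_cases h : α = 0
    · subst h; norm_num [expQuot]
    · simp only [expQuot, if_neg h, e2, one_mul]
      field_simp
      ring
  · rw [vM]; exact tendsto_varUnsuccessfulProbes hm hpos hle hlim P
  · rw [vM, e2, e3, e4]; ring
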